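/- Let $\mathbb{F}$ be a field of characteristic $3$ and let $n>1$ be an integer. Let $\mathcal{O}(2;(1,n))$ be the truncated divided power algebra, i.e. the commutative $\mathbb{F}$-algebra with basis the monomials $x^{(a)}=x_1^{(a_1)}x_2^{(a_2)}$, $0\le a_1<3$, $0\le a_2<3^n$, and product $x^{(a)}x^{(b)}=\binom{a_1+b_1}{b_1}\binom{a_2+b_2}{b_2}x^{(a+b)}$, where $x^{(c)}=0$ if $c$ is out of range. Let $\partial_1,\partial_2$ be its derivations with $\partial_1(x_1^{(a_1)}x_2^{(a_2)})=x_1^{(a_1-1)}x_2^{(a_2)}$ and $\partial_2(x_1^{(a_1)}x_2^{(a_2)})=x_1^{(a_1)}x_2^{(a_2-1)}$ (with $x_i^{(-1)}=0$), and put $D_H(f)=\partial_1(f)\partial_2-\partial_2(f)\partial_1$. Let $$\mathfrak{g}=H(2;(1,n))^{(2)}=\mathrm{span}_{\mathbb{F}}\{D_H(x^{(a)})\mid 0<a<\tau\},\qquad \tau=(2,3^n-1),$$ where exponents are ordered componentwise, be the Hamiltonian Lie algebra, with the commutator of derivations as its Lie bracket. Then its outer derivation algebra $\mathrm{Out}(\mathfrak{g})=\mathrm{Der}(\mathfrak{g})/\mathrm{Inn}(\mathfrak{g})$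 is isomorphic, as a Lie algebra over $\mathbb{F}$, to $$(\mathfrak{sl}_2(\mathbb{F})\ltimes V(2))\oplus\mathbb{F}^{n-1},$$ where $V(2)=\mathbb{F}^2$ is the natural $\mathfrak{sl}_2(\mathbb{F})$-module, regarded as an abelian ideal, and $\mathbb{F}^{n-1}$ is an abelian Lie algebra. In particular $\dim_{\mathbb{F}}\mathrm{Out}(\mathfrak{g})=n+4$. -/

import Mathlib

noncomputable section

/-- The truncated divided power algebra `O(2; (n₁, n₂))` for the prime `p`: the vector space with
basis the monomials `x₁^(a₁) x₂^(a₂)`, `0 ≤ aᵢ < p ^ nᵢ`. -/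
def DivPow (F : Type*) [Field F] (p n₁ n₂ : ℕ) : Type _ :=
  Fin (p ^ n₁) × Fin (p ^ n₂) →₀ F

namespace DivPow

section Ring

variable {F : Type*} [Field F] {p n₁ n₂ : ℕ}

instance : AddCommGroup (DivPow F p n₁ n₂) :=
  inferInstanceAs (AddCommGroup (Fin (p ^ n₁) × Fin (p ^ n₂) →₀ F))

instance : Module F (DivPow F p n₁ n₂) :=
  inferInstanceAs (Module F (Fin (p ^ n₁) × Fin (p ^ n₂) →₀ F))

/-- The basis of monomials. -/
def basis : Module.Basis (Fin (p ^ n₁) × Fin (p ^ n₂)) F (DivPow F p n₁ n₂) :=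
  ⟨LinearEquiv.refl F (Fin (p ^ n₁) × Fin (p ^ n₂) →₀ F)⟩

/-- The monomial `x^(c) = x₁^(c₁) x₂^(c₂)`; it is `0` when the exponent is out of range. -/
def mon (c : ℕ × ℕ) : DivPow F p n₁ n₂ :=
  if h : c.1 < p ^ n₁ ∧ c.2 < p ^ n₂ then basis (⟨c.1, h.1⟩, ⟨c.2, h.2⟩) else 0

/-- The linear map out of `O(2; (n₁, n₂))` with prescribed values on the monomials. -/
def lift {M : Type*} [AddCommGroup M] [Module F M] (g : ℕ × ℕ → M) :
    DivPow F p n₁ n₂ →ₗ[F] M :=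
  basis.constr F fun a => g ((a.1 : ℕ), (a.2 : ℕ))

theorem lift_mon {M : Type*} [AddCommGroup M] [Module F M] (g : ℕ × ℕ → M) (c : ℕ × ℕ)
    (h : c.1 < p ^ n₁ ∧ c.2 < p ^ n₂) :
    lift g (mon c : DivPow F p n₁ n₂) = g c := by
  unfold lift mon
  rw [dif_pos h, Module.Basis.constr_basis]

theorem mon_eq_zero (c : ℕ × ℕ) (h : ¬ (c.1 < p ^ n₁ ∧ c.2 < p ^ n₂)) :
    (mon c : DivPow F p n₁ n₂) = 0 := dif_neg h

theorem lift_mon' {M : Type*} [AddCommGroup M] [Module F M] (g : ℕ × ℕ → M) (c : ℕ × ℕ)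
    (hg : ¬ (c.1 < p ^ n₁ ∧ c.2 < p ^ n₂) → g c = 0) :
    lift g (mon c : DivPow F p n₁ n₂) = g c := by
  by_cases h : c.1 < p ^ n₁ ∧ c.2 < p ^ n₂
  · exact lift_mon g c h
  · rw [mon_eq_zero c h, map_zero, hg h]

theorem hom_ext {M : Type*} [AddCommGroup M] [Module F M] {f g : DivPow F p n₁ n₂ →ₗ[F] M}
    (h : ∀ c : ℕ × ℕ, c.1 < p ^ n₁ ∧ c.2 < p ^ n₂ → f (mon c) = g (mon c)) : f = g := by
  refine basis.ext fun a => ?_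
  have := h ((a.1 : ℕ), (a.2 : ℕ)) ⟨a.1.2, a.2.2⟩
  unfold mon at this
  rwa [dif_pos ⟨a.1.2, a.2.2⟩] at this

/-- The product `x^(a) x^(b) = binom(a + b, b) x^(a + b)`, extended bilinearly. -/
def mulHom : DivPow F p n₁ n₂ →ₗ[F] DivPow F p n₁ n₂ →ₗ[F] DivPow F p n₁ n₂ :=
  lift fun a => lift fun b =>
    (((a.1 + b.1).choose b.1 * (a.2 + b.2).choose b.2 : ℕ) : F) • mon (a + b)

instance : Mul (DivPow F p n₁ n₂) := ⟨fun f g => mulHom f g⟩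

instance : One (DivPow F p n₁ n₂) := ⟨mon 0⟩

theorem mul_def (f g : DivPow F p n₁ n₂) : f * g = mulHom f g := rfl

theorem one_def : (1 : DivPow F p n₁ n₂) = mon 0 := rfl

theorem mon_mul_mon (a b : ℕ × ℕ) :
    (mon a * mon b : DivPow F p n₁ n₂) =
      (((a.1 + b.1).choose b.1 * (a.2 + b.2).choose b.2 : ℕ) : F) • mon (a + b) := by
  have key : ∀ a b : ℕ × ℕ, ¬ (a.1 < p ^ n₁ ∧ a.2 < p ^ n₂) ∨ ¬ (b.1 < p ^ n₁ ∧ b.2 < p ^ n₂) →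
      (mon (a + b) : DivPow F p n₁ n₂) = 0 := fun a b h => mon_eq_zero _ (by
    simp only [Prod.fst_add, Prod.snd_add]; omega)
  rw [mul_def]
  unfold mulHom
  by_cases ha : a.1 < p ^ n₁ ∧ a.2 < p ^ n₂
  · rw [lift_mon _ _ ha]
    exact lift_mon' _ _ fun hb => by rw [key a b (Or.inr hb), smul_zero]
  · rw [mon_eq_zero a ha, map_zero, LinearMap.zero_apply, key a b (Or.inl ha), smul_zero]

instance : CommRing (DivPow F p n₁ n₂) where
  __ := (inferInstance : AddCommGroup (DivPow F p n₁ n₂))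
  left_distrib f g h := map_add (mulHom f) g h
  right_distrib f g h := by simp only [mul_def, map_add, LinearMap.add_apply]
  zero_mul f := by simp only [mul_def, map_zero, LinearMap.zero_apply]
  mul_zero f := map_zero (mulHom f)
  mul_assoc f g h := by
    have e1 : ∀ a b c : ℕ × ℕ, (mon a * mon b * mon c : DivPow F p n₁ n₂) =
        mon a * (mon b * mon c) := fun a b c => by
      have key : ∀ x y z : ℕ, (x + y).choose y * (x + y + z).choose z =
          (y + z).choose z * (x + (y + z)).choose (y + z) := fun x y z => by
        have h : (x + y + z).choose (y + z) * (y + z).choose z =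
            (x + y + z).choose z * (x + y + z - z).choose (y + z - z) :=
          Nat.choose_mul (by omega)
        rw [show x + y + z - z = x + y by omega, show y + z - z = y by omega] at h
        rw [← add_assoc, mul_comm, ← h, mul_comm]
      rw [mon_mul_mon, mon_mul_mon]
      simp only [mul_def, map_smul, LinearMap.smul_apply]
      simp only [← mul_def, mon_mul_mon, smul_smul, ← Nat.cast_mul, Prod.fst_add, Prod.snd_add,
        add_assoc a b c]
      rw [mul_mul_mul_comm, key, key, mul_mul_mul_comm]
    have e2 : ∀ (a b : ℕ × ℕ) (h : DivPow F p n₁ n₂), mon a * mon b * h = mon a * (mon b * h) :=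
      fun a b h => congrArg (fun φ => φ h) (show mulHom (mon a * mon b) =
        mulHom (mon a) ∘ₗ mulHom (mon b) from hom_ext fun c _ => e1 a b c)
    have e3 : ∀ (a : ℕ × ℕ) (g h : DivPow F p n₁ n₂), mon a * g * h = mon a * (g * h) :=
      fun a g h => congrArg (fun φ => φ g) (show mulHom.flip h ∘ₗ mulHom (mon a) =
        mulHom (mon a) ∘ₗ mulHom.flip h from hom_ext fun b _ => e2 a b h)
    exact congrArg (fun φ => φ f) (show mulHom.flip h ∘ₗ mulHom.flip g =
        mulHom.flip (g * h) from hom_ext fun a _ => e3 a g h)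
  one_mul f := by
    have : mulHom 1 = (LinearMap.id : DivPow F p n₁ n₂ →ₗ[F] _) := hom_ext fun c _ => by
      rw [one_def, ← mul_def, mon_mul_mon]; simp
    exact congrArg (fun φ => φ f) this
  mul_one f := by
    have : mulHom.flip 1 = (LinearMap.id : DivPow F p n₁ n₂ →ₗ[F] _) := hom_ext fun c _ => by
      rw [one_def, LinearMap.flip_apply, ← mul_def, mon_mul_mon]; simp
    exact congrArg (fun φ => φ f) this
  mul_comm f g := by
    have : mulHom.flip = (mulHom : DivPow F p n₁ n₂ →ₗ[F] _) :=
      hom_ext fun a _ => hom_ext fun b _ => by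
        rw [LinearMap.flip_apply, ← mul_def, ← mul_def, mon_mul_mon, mon_mul_mon, add_comm b a,
          add_comm b.1, add_comm b.2, Nat.choose_symm_add, Nat.choose_symm_add]
    exact congrArg (fun φ => φ g f) this

instance : Algebra F (DivPow F p n₁ n₂) :=
  Algebra.ofModule
    (fun r f g => by simp only [mul_def, map_smul, LinearMap.smul_apply])
    (fun r f g => map_smul (mulHom f) r g)

end Ring

section Derivations

variable {F : Type*} [Field F] {p n₁ n₂ : ℕ}

/-- The partial derivative `∂₁`, with `∂₁ (x₁^(a) x₂^(b)) = x₁^(a-1) x₂^(b)`. -/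
def partial₁Hom : DivPow F p n₁ n₂ →ₗ[F] DivPow F p n₁ n₂ :=
  lift fun a => if a.1 = 0 then 0 else mon (a.1 - 1, a.2)

/-- The partial derivative `∂₂`, with `∂₂ (x₁^(a) x₂^(b)) = x₁^(a) x₂^(b-1)`. -/
def partial₂Hom : DivPow F p n₁ n₂ →ₗ[F] DivPow F p n₁ n₂ :=
  lift fun a => if a.2 = 0 then 0 else mon (a.1, a.2 - 1)

theorem partial₁Hom_mon (c : ℕ × ℕ) (h : c.1 < p ^ n₁ ∧ c.2 < p ^ n₂) :
    partial₁Hom (mon c : DivPow F p n₁ n₂) = if c.1 = 0 then 0 else mon (c.1 - 1, c.2) :=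
  lift_mon _ _ h

theorem partial₂Hom_mon (c : ℕ × ℕ) (h : c.1 < p ^ n₁ ∧ c.2 < p ^ n₂) :
    partial₂Hom (mon c : DivPow F p n₁ n₂) = if c.2 = 0 then 0 else mon (c.1, c.2 - 1) :=
  lift_mon _ _ h

theorem leibniz_of_mon (D : DivPow F p n₁ n₂ →ₗ[F] DivPow F p n₁ n₂)
    (hD : ∀ a b : ℕ × ℕ, a.1 < p ^ n₁ ∧ a.2 < p ^ n₂ → b.1 < p ^ n₁ ∧ b.2 < p ^ n₂ →
      D (mon a * mon b) = mon a * D (mon b) + mon b * D (mon a))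
    (f g : DivPow F p n₁ n₂) : D (f * g) = f • D g + g • D f := by
  have e1 : ∀ a : ℕ × ℕ, a.1 < p ^ n₁ ∧ a.2 < p ^ n₂ → ∀ g : DivPow F p n₁ n₂,
      D (mon a * g) = mon a * D g + g * D (mon a) := fun a ha g =>
    congrArg (fun φ => φ g) (show D ∘ₗ mulHom (mon a) =
      mulHom (mon a) ∘ₗ D + mulHom.flip (D (mon a)) from hom_ext fun b hb => hD a b ha hb)
  exact congrArg (fun φ => φ f) (show D ∘ₗ mulHom.flip g =
    mulHom.flip (D g) + mulHom g ∘ₗ D from hom_ext fun a ha => e1 a ha g)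

variable [Fact p.Prime] [CharP F p]

theorem leibniz₁_mon (a b : ℕ × ℕ) (ha : a.1 < p ^ n₁ ∧ a.2 < p ^ n₂)
    (hb : b.1 < p ^ n₁ ∧ b.2 < p ^ n₂) :
    partial₁Hom (mon a * mon b : DivPow F p n₁ n₂) =
      mon a * partial₁Hom (mon b) + mon b * partial₁Hom (mon a) := by
  obtain ⟨a₁, a₂⟩ := a
  obtain ⟨b₁, b₂⟩ := b
  rw [mon_mul_mon, map_smul, partial₁Hom_mon _ ha, partial₁Hom_mon _ hb]
  simp only [Prod.mk_add_mk] at *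
  by_cases h2 : a₂ + b₂ < p ^ n₂
  swap
  · rw [mon_eq_zero (a₁ + b₁, a₂ + b₂) (by simp [h2]), map_zero, smul_zero]
    split_ifs <;>
      simp [mon_mul_mon, mon_eq_zero (_, a₂ + b₂), h2, add_comm b₂ a₂]
  have hs : (b₂ + a₂).choose a₂ = (a₂ + b₂).choose b₂ := by
    rw [add_comm, Nat.choose_symm_add]
  by_cases h1 : a₁ + b₁ < p ^ n₁
  · rw [partial₁Hom_mon _ ⟨h1, h2⟩]
    rcases a₁ with _ | j <;> rcases b₁ with _ | k
    · simp
    · simp [mon_mul_mon]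
    · simp [mon_mul_mon, add_comm b₂ a₂, ← hs]
    · simp only [Nat.add_eq_zero_iff, one_ne_zero, and_false, if_false, add_tsub_cancel_right,
        mon_mul_mon, Prod.mk_add_mk]
      rw [show j + 1 + (k + 1) - 1 = j + 1 + k by omega, show k + 1 + j = j + 1 + k by omega,
        add_comm b₂ a₂, ← add_smul, show j + 1 + (k + 1) = (j + 1 + k) + 1 by omega,
        Nat.choose_succ_succ, show (j + 1 + k).choose j = (j + 1 + k).choose (k + 1) by
          rw [Nat.choose_symm_of_eq_add]; omega, Nat.choose_symm_add]
      push_cast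
      congr 1
      ring
  · rw [mon_eq_zero (a₁ + b₁, a₂ + b₂) (by simp [h1]), map_zero, smul_zero]
    rcases a₁ with _ | j <;> rcases b₁ with _ | k
    · simp
    · omega
    · omega
    · simp only [Nat.add_eq_zero_iff, one_ne_zero, and_false, if_false, add_tsub_cancel_right,
        mon_mul_mon, Prod.mk_add_mk]
      rw [show k + 1 + j = j + 1 + k by omega, add_comm b₂ a₂, ← add_smul]
      by_cases h3 : j + 1 + k < p ^ n₁
      · have hp : p ^ n₁ = (j + 1 + k) + 1 := by omega
        have hd : ((((j + 1 + k) + 1).choose (k + 1) : ℕ) : F) = 0 := by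
          rw [CharP.cast_eq_zero_iff F p, ← hp]
          exact Nat.Prime.dvd_choose_pow Fact.out (by omega) (by omega)
        rw [Nat.choose_succ_succ, Nat.cast_add] at hd
        rw [show (j + 1 + k).choose j = (j + 1 + k).choose (k + 1) by
          rw [Nat.choose_symm_of_eq_add]; omega, Nat.choose_symm_add, Nat.cast_mul, Nat.cast_mul,
          ← add_mul, hd, zero_mul, zero_smul]
      · rw [mon_eq_zero _ (by simp [h3]), smul_zero]

theorem leibniz₂_mon (a b : ℕ × ℕ) (ha : a.1 < p ^ n₁ ∧ a.2 < p ^ n₂)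
    (hb : b.1 < p ^ n₁ ∧ b.2 < p ^ n₂) :
    partial₂Hom (mon a * mon b : DivPow F p n₁ n₂) =
      mon a * partial₂Hom (mon b) + mon b * partial₂Hom (mon a) := by
  obtain ⟨a₁, a₂⟩ := a
  obtain ⟨b₁, b₂⟩ := b
  rw [mon_mul_mon, map_smul, partial₂Hom_mon _ ha, partial₂Hom_mon _ hb]
  simp only [Prod.mk_add_mk] at *
  by_cases h2 : a₁ + b₁ < p ^ n₁
  swap
  · rw [mon_eq_zero (a₁ + b₁, a₂ + b₂) (by simp [h2]), map_zero, smul_zero]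
    split_ifs <;>
      simp [mon_mul_mon, mon_eq_zero (a₁ + b₁, _), h2, add_comm b₁ a₁]
  have hs : (b₁ + a₁).choose a₁ = (a₁ + b₁).choose b₁ := by
    rw [add_comm, Nat.choose_symm_add]
  by_cases h1 : a₂ + b₂ < p ^ n₂
  · rw [partial₂Hom_mon _ ⟨h2, h1⟩]
    rcases a₂ with _ | j <;> rcases b₂ with _ | k
    · simp
    · simp [mon_mul_mon]
    · simp [mon_mul_mon, add_comm b₁ a₁, ← hs]
    · simp only [Nat.add_eq_zero_iff, one_ne_zero, and_false, if_false, add_tsub_cancel_right,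
        mon_mul_mon, Prod.mk_add_mk]
      rw [show j + 1 + (k + 1) - 1 = j + 1 + k by omega, show k + 1 + j = j + 1 + k by omega,
        add_comm b₁ a₁, ← add_smul, show j + 1 + (k + 1) = (j + 1 + k) + 1 by omega,
        Nat.choose_succ_succ, show (j + 1 + k).choose j = (j + 1 + k).choose (k + 1) by
          rw [Nat.choose_symm_of_eq_add]; omega, Nat.choose_symm_add]
      push_cast
      congr 1
      ring
  · rw [mon_eq_zero (a₁ + b₁, a₂ + b₂) (by simp [h1]), map_zero, smul_zero]
    rcases a₂ with _ | j <;> rcases b₂ with _ | k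
    · simp
    · omega
    · omega
    · simp only [Nat.add_eq_zero_iff, one_ne_zero, and_false, if_false, add_tsub_cancel_right,
        mon_mul_mon, Prod.mk_add_mk]
      rw [show k + 1 + j = j + 1 + k by omega, add_comm b₁ a₁, ← add_smul]
      by_cases h3 : j + 1 + k < p ^ n₂
      · have hp : p ^ n₂ = (j + 1 + k) + 1 := by omega
        have hd : ((((j + 1 + k) + 1).choose (k + 1) : ℕ) : F) = 0 := by
          rw [CharP.cast_eq_zero_iff F p, ← hp]
          exact Nat.Prime.dvd_choose_pow Fact.out (by omega) (by omega)
        rw [Nat.choose_succ_succ, Nat.cast_add] at hd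
        rw [show (j + 1 + k).choose j = (j + 1 + k).choose (k + 1) by
          rw [Nat.choose_symm_of_eq_add]; omega, Nat.choose_symm_add, Nat.cast_mul, Nat.cast_mul,
          ← mul_add, hd, mul_zero, zero_smul]
      · rw [mon_eq_zero _ (by simp [h3]), smul_zero]

variable (F p n₁ n₂) in
/-- The derivation `∂₁` of the algebra `O(2; (n₁, n₂))`. -/
def partial₁ : Derivation F (DivPow F p n₁ n₂) (DivPow F p n₁ n₂) :=
  Derivation.mk' partial₁Hom (leibniz_of_mon _ leibniz₁_mon)

variable (F p n₁ n₂) in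
/-- The derivation `∂₂` of the algebra `O(2; (n₁, n₂))`. -/
def partial₂ : Derivation F (DivPow F p n₁ n₂) (DivPow F p n₁ n₂) :=
  Derivation.mk' partial₂Hom (leibniz_of_mon _ leibniz₂_mon)

theorem partial₁_apply (f : DivPow F p n₁ n₂) : partial₁ F p n₁ n₂ f = partial₁Hom f := rfl

theorem partial₂_apply (f : DivPow F p n₁ n₂) : partial₂ F p n₁ n₂ f = partial₂Hom f := rfl

theorem partial_comm (f : DivPow F p n₁ n₂) :
    partial₁ F p n₁ n₂ (partial₂ F p n₁ n₂ f) = partial₂ F p n₁ n₂ (partial₁ F p n₁ n₂ f) := by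
  simp only [partial₁_apply, partial₂_apply]
  refine congrArg (fun φ => φ f) (show (partial₁Hom : DivPow F p n₁ n₂ →ₗ[F] _) ∘ₗ partial₂Hom =
    partial₂Hom ∘ₗ partial₁Hom from hom_ext fun c hc => ?_)
  simp only [LinearMap.comp_apply, partial₁Hom_mon c hc, partial₂Hom_mon c hc]
  have h1 : ∀ k, (partial₁Hom (mon (c.1, c.2 - k)) : DivPow F p n₁ n₂) =
      if c.1 = 0 then 0 else mon (c.1 - 1, c.2 - k) := fun k =>
    partial₁Hom_mon _ ⟨hc.1, (Nat.sub_le _ _).trans_lt hc.2⟩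
  have h2 : ∀ k, (partial₂Hom (mon (c.1 - k, c.2)) : DivPow F p n₁ n₂) =
      if c.2 = 0 then 0 else mon (c.1 - k, c.2 - 1) := fun k =>
    partial₂Hom_mon _ ⟨(Nat.sub_le _ _).trans_lt hc.1, hc.2⟩
  split_ifs with h3 h4 h4
  · simp
  · rw [h2, if_pos h3, map_zero]
  · rw [h1, if_pos h4, map_zero]
  · rw [h1, h2, if_neg h3, if_neg h4]

variable (F p n₁ n₂) in
/-- The operator `D_H(f) = ∂₁(f) ∂₂ - ∂₂(f) ∂₁` from `O(2; (n₁, n₂))` to the generalized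
Jacobson-Witt algebra `O ∂₁ + O ∂₂`, whose bracket is the commutator of derivations of `O`. -/
def DH : DivPow F p n₁ n₂ →ₗ[F] Derivation F (DivPow F p n₁ n₂) (DivPow F p n₁ n₂) where
  toFun f := partial₁ F p n₁ n₂ f • partial₂ F p n₁ n₂ - partial₂ F p n₁ n₂ f • partial₁ F p n₁ n₂
  map_add' f g := by simp only [map_add, add_smul]; abel
  map_smul' r f := by simp only [Derivation.map_smul, smul_assoc, smul_sub, RingHom.id_apply]

theorem DH_apply (f g : DivPow F p n₁ n₂) :
    DH F p n₁ n₂ f g = partial₁ F p n₁ n₂ f * partial₂ F p n₁ n₂ g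
      - partial₂ F p n₁ n₂ f * partial₁ F p n₁ n₂ g := rfl

theorem lie_DH (f g : DivPow F p n₁ n₂) :
    ⁅DH F p n₁ n₂ f, DH F p n₁ n₂ g⁆ = DH F p n₁ n₂ (DH F p n₁ n₂ f g) := by
  ext h
  rw [Derivation.commutator_apply]
  simp only [DH_apply, (partial₁ F p n₁ n₂).map_sub, (partial₂ F p n₁ n₂).map_sub,
    Derivation.leibniz, smul_eq_mul, partial_comm]
  ring

variable (p n₁ n₂) in
/-- The maximal exponent `τ = (p ^ n₁ - 1, p ^ n₂ - 1)`. -/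
def tau : ℕ × ℕ := (p ^ n₁ - 1, p ^ n₂ - 1)

theorem partial₁_mem (f : DivPow F p n₁ n₂) :
    partial₁ F p n₁ n₂ f ∈ Submodule.span F {g | ∃ a : ℕ × ℕ, a < tau p n₁ n₂ ∧ g = mon a} := by
  set S := Submodule.span F {g : DivPow F p n₁ n₂ | ∃ a : ℕ × ℕ, a < tau p n₁ n₂ ∧ g = mon a}
  have : S.mkQ ∘ₗ partial₁Hom = 0 := hom_ext fun c hc => by
    rw [LinearMap.comp_apply, partial₁Hom_mon c hc, LinearMap.zero_apply, Submodule.mkQ_apply,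
      Submodule.Quotient.mk_eq_zero]
    split_ifs with h
    · exact zero_mem _
    · refine Submodule.subset_span ⟨_, ?_, rfl⟩
      unfold tau
      rw [Prod.mk_lt_mk]
      omega
  exact (Submodule.Quotient.mk_eq_zero S).1 (congrArg (fun φ => φ f) this)

theorem partial₂_mem (f : DivPow F p n₁ n₂) :
    partial₂ F p n₁ n₂ f ∈ Submodule.span F {g | ∃ a : ℕ × ℕ, a < tau p n₁ n₂ ∧ g = mon a} := by
  set S := Submodule.span F {g : DivPow F p n₁ n₂ | ∃ a : ℕ × ℕ, a < tau p n₁ n₂ ∧ g = mon a}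
  have : S.mkQ ∘ₗ partial₂Hom = 0 := hom_ext fun c hc => by
    rw [LinearMap.comp_apply, partial₂Hom_mon c hc, LinearMap.zero_apply, Submodule.mkQ_apply,
      Submodule.Quotient.mk_eq_zero]
    split_ifs with h
    · exact zero_mem _
    · refine Submodule.subset_span ⟨_, ?_, rfl⟩
      unfold tau
      rw [Prod.mk_lt_mk]
      omega
  exact (Submodule.Quotient.mk_eq_zero S).1 (congrArg (fun φ => φ f) this)

variable (F p n₁ n₂) in
/-- The span of the `D_H(x^(a))` with `0 < a < τ` for the componentwise order on exponents. -/
def hamiltonianSpan : Submodule F (Derivation F (DivPow F p n₁ n₂) (DivPow F p n₁ n₂)) :=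
  Submodule.span F {D | ∃ a : ℕ × ℕ, 0 < a ∧ a < tau p n₁ n₂ ∧ D = DH F p n₁ n₂ (mon a)}

theorem hamiltonianSpan_le :
    hamiltonianSpan F p n₁ n₂ ≤ LinearMap.range (DH F p n₁ n₂) :=
  Submodule.span_le.2 fun _ ⟨a, _, _, h⟩ => ⟨mon a, h.symm⟩

theorem DH_mem {f : DivPow F p n₁ n₂}
    (hf : f ∈ Submodule.span F {g | ∃ a : ℕ × ℕ, a < tau p n₁ n₂ ∧ g = mon a}) :
    DH F p n₁ n₂ f ∈ hamiltonianSpan F p n₁ n₂ := by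
  refine (Submodule.span_le (p := (hamiltonianSpan F p n₁ n₂).comap (DH F p n₁ n₂))).2 ?_ hf
  rintro _ ⟨a, ha, rfl⟩
  by_cases h0 : a = 0
  · have : DH F p n₁ n₂ (mon a) = 0 := by
      ext g
      rw [DH_apply, h0, ← one_def, Derivation.map_one_eq_zero, Derivation.map_one_eq_zero]
      simp
    change DH F p n₁ n₂ (mon a) ∈ hamiltonianSpan F p n₁ n₂
    rw [this]
    exact zero_mem _
  · exact Submodule.subset_span ⟨a, pos_iff_ne_zero.2 h0, ha, rfl⟩

end Derivations

end DivPow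

/-- The Hamiltonian algebra `H(2; (n₁, n₂))^(2) = span {D_H(x^(a)) | 0 < a < τ}`, a Lie subalgebra
of the Lie algebra of derivations of `O(2; (n₁, n₂))`. -/
def Hamiltonian₂ (F : Type*) [Field F] (p : ℕ) [Fact p.Prime] [CharP F p] (n₁ n₂ : ℕ) :
    LieSubalgebra F (Derivation F (DivPow F p n₁ n₂) (DivPow F p n₁ n₂)) where
  __ := DivPow.hamiltonianSpan F p n₁ n₂
  lie_mem' := by
    intro x y hx hy
    obtain ⟨f, rfl⟩ := DivPow.hamiltonianSpan_le hx
    obtain ⟨g, rfl⟩ := DivPow.hamiltonianSpan_le hy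
    rw [DivPow.lie_DH]
    refine DivPow.DH_mem ?_
    have h : DivPow.DH F p n₁ n₂ f g =
        DivPow.partial₂ F p n₁ n₂ (g * DivPow.partial₁ F p n₁ n₂ f)
          - DivPow.partial₁ F p n₁ n₂ (g * DivPow.partial₂ F p n₁ n₂ f) := by
      simp only [DivPow.DH_apply, Derivation.leibniz, smul_eq_mul, DivPow.partial_comm]
      ring
    rw [h]
    exact sub_mem (DivPow.partial₂_mem _) (DivPow.partial₁_mem _)

/-- The outer derivation algebra `Der(L) / Inn(L)`, where `Inn(L)` is the ideal of the inner
derivations `ad x`. -/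
abbrev OuterDerivations (F L : Type*) [CommRing F] [LieRing L] [LieAlgebra F L] : Type _ :=
  LieDerivation F L L ⧸ (LieDerivation.ad F L).idealRange

/-- The abelian Lie algebra `F^k`. -/
def AbelianLie (F : Type*) [Field F] (k : ℕ) : Type _ := Fin k → F

namespace AbelianLie

variable {F : Type*} [Field F] {k : ℕ}

instance : AddCommGroup (AbelianLie F k) := inferInstanceAs (AddCommGroup (Fin k → F))

instance : Module F (AbelianLie F k) := inferInstanceAs (Module F (Fin k → F))

instance : LieRing (AbelianLie F k) where
  bracket _ _ := 0
  add_lie _ _ _ := (add_zero _).symm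
  lie_add _ _ _ := (add_zero _).symm
  lie_self _ := rfl
  leibniz_lie _ _ _ := (add_zero _).symm

instance : LieAlgebra F (AbelianLie F k) where
  lie_smul r _ _ := (smul_zero r).symm

theorem lie_eq_zero (v w : AbelianLie F k) : ⁅v, w⁆ = 0 := rfl

end AbelianLie

/-- The action of `sl₂(F)` on its natural module `V(2) = F²` by matrix multiplication, as
derivations of the abelian Lie algebra `F²`. -/
def sl₂NaturalAction (F : Type*) [Field F] :
    LieAlgebra.SpecialLinear.sl (Fin 2) F →ₗ⁅F⁆
      LieDerivation F (AbelianLie F 2) (AbelianLie F 2) where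
  toFun A :=
    { toLinearMap := (Matrix.mulVecLin A.val : (Fin 2 → F) →ₗ[F] (Fin 2 → F))
      leibniz' := fun _ _ => (Matrix.mulVec_zero A.val).trans (sub_zero _).symm }
  map_add' A B := LieDerivation.ext fun v => Matrix.add_mulVec A.val B.val v
  map_smul' r A := LieDerivation.ext fun v => Matrix.smul_mulVec r A.val v
  map_lie' := by
    intro A B
    refine LieDerivation.ext fun v => ?_
    rw [LieDerivation.commutator_apply]
    have h : ∀ v : Fin 2 → F, (A.val * B.val - B.val * A.val).mulVec v =
        A.val.mulVec (B.val.mulVec v) - B.val.mulVec (A.val.mulVec v) := fun v => by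
      rw [Matrix.sub_mulVec, Matrix.mulVec_mulVec, Matrix.mulVec_mulVec]
    exact h v

/-- The semidirect product `sl₂(F) ⋉ V(2)`, with `V(2)` an abelian ideal. -/
abbrev Sl₂SemidirectV₂ (F : Type*) [Field F] : Type _ :=
  LieAlgebra.SemiDirectSum (AbelianLie F 2) (LieAlgebra.SpecialLinear.sl (Fin 2) F)
    (sl₂NaturalAction F)

end

/-!
# Outer derivations of `H(2; (1, n))^(2)` in characteristic three

In characteristic three the algebra has a description with an evident `sl₂`-symmetry. Let
`A = O(1; n)` be the one-variable divided power algebra with its derivation `'`, let `A'` be the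
image of `'`, which is spanned by all divided powers except the top one, and let `V = F²` with its
symplectic form `ω`. Then `H(2; (1, n))^(2)` is isomorphic to `A ⊕ (A' ⊗ V)` with the bracket
`[a, b] = ab' - a'b`, `[a, f ⊗ v] = (af)' ⊗ v`, `[f ⊗ v, g ⊗ w] = ω(v, w) fg`
(`DoubledWitt`, `DivPow.modelEquiv`). The summand `A` corresponds to the `D_H(x₁ a)`, and the two
coordinates of `A' ⊗ V` to the `D_H(x₁^(2) f)` and to the `D_H(G)` with `G' = g`. These last two
families are isomorphic modules over the Witt algebra `A` only because `3 = 0`.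

On this model the outer derivations are visible (`DoubledWitt.outer`): `sl₂` acts on `V`, the
bracket with `X ⊗ v` makes sense for the top divided power `X`, although `X ∉ A'`, and the powers
`(d/dx)^(3^j)`, `1 ≤ j < n`, are derivations of `A`. They satisfy the relations of
`(sl₂ ⋉ V) ⊕ F^(n-1)` up to inner derivations (`DivPow.lie_outerRep`), and no nonzero combination of
them is inner (`DivPow.eq_zero_of_outerRep_eq_ad`).

That there are no others (`DivPow.exists_eq_outerRep_add_ad`) is seen by normalizing a derivation
`D`. Subtracting an inner derivation and a bracket with `X ⊗ v` gives `D(1) = 0`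
(`DivPow.exists_sub_apply_mk_one`), so that `D` commutes with `'`. Then `D` maps `V` to constants,
and subtracting an element of `sl₂` and another inner derivation makes `D` vanish on `V` and on
`x ∈ A` as well. Such a `D` preserves `A` and acts on `A` and on both coordinates of `A' ⊗ V` by one
linear map `δ` that commutes with `'` and obeys the Leibniz rule for products of elements of `A'`.
Commuting with `'` means that `δ = ∑ c_m (d/dx)^m`, where `c_m` is the constant term of `δ(x^(m))`,
and the Leibniz rule gives `binom(m, k) c_m = 0` for `0 < k < m`. Hence `c_m = 0` unless `m` is a
power of three.
-/

noncomputable section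

theorem algebra_three_eq_zero (F A : Type*) [Field F] [CharP F 3] [CommRing A] [Algebra F A] :
    (3 : A) = 0 := by
  have h : (algebraMap F A) ((3 : ℕ) : F) = 0 := by rw [CharP.cast_eq_zero, map_zero]
  rwa [map_natCast] at h

/-! ### The Lie algebra `A ⊕ (dA ⊗ F²)` -/

/-- For a derivation `d` of a commutative `F`-algebra `A`, the space `A ⊕ (dA ⊗ F²)`, with `dA ⊗ F²`
written as two copies of the image `dA` of `d`. In characteristic three it is a Lie algebra whose
even part `A` stands for the derivations `a d`. -/
def DoubledWitt {F A : Type*} [Field F] [CommRing A] [Algebra F A] (d : Derivation F A A) :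
    Type _ :=
  A × LinearMap.range (d : A →ₗ[F] A) × LinearMap.range (d : A →ₗ[F] A)

namespace DoubledWitt

variable {F A : Type*} [Field F] [CommRing A] [Algebra F A] {d : Derivation F A A}

instance : AddCommGroup (DoubledWitt d) :=
  inferInstanceAs (AddCommGroup
    (A × LinearMap.range (d : A →ₗ[F] A) × LinearMap.range (d : A →ₗ[F] A)))

instance : Module F (DoubledWitt d) :=
  inferInstanceAs (Module F
    (A × LinearMap.range (d : A →ₗ[F] A) × LinearMap.range (d : A →ₗ[F] A)))

/-- The component in `A`. -/
def ev : DoubledWitt d →ₗ[F] A :=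
  LinearMap.fst F A (LinearMap.range (d : A →ₗ[F] A) × LinearMap.range (d : A →ₗ[F] A))

/-- The first coordinate of the component in `dA ⊗ F²`. -/
def od₁ : DoubledWitt d →ₗ[F] A :=
  (LinearMap.range (d : A →ₗ[F] A)).subtype ∘ₗ LinearMap.fst F _ _ ∘ₗ
    LinearMap.snd F A (LinearMap.range (d : A →ₗ[F] A) × LinearMap.range (d : A →ₗ[F] A))

/-- The second coordinate of the component in `dA ⊗ F²`. -/
def od₂ : DoubledWitt d →ₗ[F] A :=
  (LinearMap.range (d : A →ₗ[F] A)).subtype ∘ₗ LinearMap.snd F _ _ ∘ₗ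
    LinearMap.snd F A (LinearMap.range (d : A →ₗ[F] A) × LinearMap.range (d : A →ₗ[F] A))

@[ext]
theorem ext {x y : DoubledWitt d} (h : ev x = ev y) (h₁ : od₁ x = od₁ y) (h₂ : od₂ x = od₂ y) :
    x = y :=
  Prod.ext h (Prod.ext (Subtype.ext h₁) (Subtype.ext h₂))

variable (d) in
/-- The element with components `a`, `d f`, `d g`.
In particular `1 ⊗ e₁` is `mk d 0 x 0` if `d x = 1`. -/
def mk (a f g : A) : DoubledWitt d := (a, ⟨d f, f, rfl⟩, ⟨d g, g, rfl⟩)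

@[simp] theorem ev_mk (a f g : A) : ev (mk d a f g) = a := rfl

@[simp] theorem od₁_mk (a f g : A) : od₁ (mk d a f g) = d f := rfl

@[simp] theorem od₂_mk (a f g : A) : od₂ (mk d a f g) = d g := rfl

theorem exists_od₁ (x : DoubledWitt d) : ∃ f, d f = od₁ x := x.2.1.2

theorem exists_od₂ (x : DoubledWitt d) : ∃ f, d f = od₂ x := x.2.2.2

theorem exists_mk (x : DoubledWitt d) : ∃ a f g, x = mk d a f g := by
  obtain ⟨f, hf⟩ := exists_od₁ x
  obtain ⟨g, hg⟩ := exists_od₂ x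
  exact ⟨ev x, f, g, ext rfl hf.symm hg.symm⟩

/-- The bracket `[a, b] = a d(b) - d(a) b`, `[a, f ⊗ v] = d(af) ⊗ v`,
`[f ⊗ v, g ⊗ w] = ω(v, w) fg`. -/
instance : Bracket (DoubledWitt d) (DoubledWitt d) where
  bracket x y := mk d
    (ev x * d (ev y) - d (ev x) * ev y + od₁ x * od₂ y - od₂ x * od₁ y)
    (ev x * od₁ y - ev y * od₁ x) (ev x * od₂ y - ev y * od₂ x)

@[simp] theorem ev_lie (x y : DoubledWitt d) :
    ev ⁅x, y⁆ = ev x * d (ev y) - d (ev x) * ev y + od₁ x * od₂ y - od₂ x * od₁ y := rfl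

@[simp] theorem od₁_lie (x y : DoubledWitt d) :
    od₁ ⁅x, y⁆ = d (ev x * od₁ y - ev y * od₁ x) := rfl

@[simp] theorem od₂_lie (x y : DoubledWitt d) :
    od₂ ⁅x, y⁆ = d (ev x * od₂ y - ev y * od₂ x) := rfl

variable (d) in
/-- The derivations of `A` that commute with `d`. -/
def commutingDerivations : Submodule F (Derivation F A A) where
  carrier := {δ | ∀ a, δ (d a) = d (δ a)}
  add_mem' h₁ h₂ a := by simp [h₁ a, h₂ a]
  zero_mem' a := by simp
  smul_mem' r δ h a := by simp [h a]

/-- The linear endomorphism with the three given components. -/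
def ofComponents (φ φ₁ φ₂ : DoubledWitt d →ₗ[F] A)
    (h₁ : ∀ x, φ₁ x ∈ LinearMap.range (d : A →ₗ[F] A))
    (h₂ : ∀ x, φ₂ x ∈ LinearMap.range (d : A →ₗ[F] A)) : DoubledWitt d →ₗ[F] DoubledWitt d :=
  φ.prod ((φ₁.codRestrict _ h₁).prod (φ₂.codRestrict _ h₂))

/-- The sum of three endomorphisms: `δ` acts on `A` and on both coordinates of `dA ⊗ F²`, the matrix
`T` acts on the factor `F²`, and the third one is the bracket with `z₁ ⊗ e₁ + z₂ ⊗ e₂`, where `z₁`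
and `z₂` need not lie in `dA`. -/
def outerLin (δ : commutingDerivations d) (T : Matrix (Fin 2) (Fin 2) F) (z₁ z₂ : A) :
    DoubledWitt d →ₗ[F] DoubledWitt d :=
  ofComponents
    ((δ.1 : A →ₗ[F] A) ∘ₗ ev + LinearMap.mulLeft F z₁ ∘ₗ od₂ - LinearMap.mulLeft F z₂ ∘ₗ od₁)
    ((δ.1 : A →ₗ[F] A) ∘ₗ od₁ + (T 0 0 • od₁ + T 0 1 • od₂)
      - (d : A →ₗ[F] A) ∘ₗ LinearMap.mulRight F z₁ ∘ₗ ev)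
    ((δ.1 : A →ₗ[F] A) ∘ₗ od₂ + (T 1 0 • od₁ + T 1 1 • od₂)
      - (d : A →ₗ[F] A) ∘ₗ LinearMap.mulRight F z₂ ∘ₗ ev)
    (fun x => by
      obtain ⟨a, f, g, rfl⟩ := exists_mk x
      exact ⟨δ.1 f + (T 0 0 • f + T 0 1 • g) - a * z₁, by simp [δ.2 f]⟩)
    (fun x => by
      obtain ⟨a, f, g, rfl⟩ := exists_mk x
      exact ⟨δ.1 g + (T 1 0 • f + T 1 1 • g) - a * z₂, by simp [δ.2 g]⟩)

section

variable (δ : commutingDerivations d) (T : Matrix (Fin 2) (Fin 2) F) (z₁ z₂ : A)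
  (x : DoubledWitt d)

theorem ev_outerLin :
    ev (outerLin δ T z₁ z₂ x) = δ.1 (ev x) + z₁ * od₂ x - z₂ * od₁ x := rfl

theorem od₁_outerLin :
    od₁ (outerLin δ T z₁ z₂ x) = δ.1 (od₁ x) + (T 0 0 • od₁ x + T 0 1 • od₂ x) - d (ev x * z₁) :=
  rfl

theorem od₂_outerLin :
    od₂ (outerLin δ T z₁ z₂ x) = δ.1 (od₂ x) + (T 1 0 • od₁ x + T 1 1 • od₂ x) - d (ev x * z₂) :=
  rfl

end

section CharThree

variable [CharP F 3]

instance : LieRing (DoubledWitt d) where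
  add_lie x y z := by
    ext <;> simp only [ev_lie, od₁_lie, od₂_lie, map_add, map_sub, Derivation.leibniz,
      smul_eq_mul] <;> ring
  lie_add x y z := by
    ext <;> simp only [ev_lie, od₁_lie, od₂_lie, map_add, map_sub, Derivation.leibniz,
      smul_eq_mul] <;> ring
  lie_self x := by ext <;> (simp; try ring)
  leibniz_lie x y z := by
    ext
    · simp only [ev_lie, od₁_lie, od₂_lie, map_add, map_sub, Derivation.leibniz, smul_eq_mul]
      linear_combination (od₁ y * d (ev z) * od₂ x - od₁ y * od₂ z * d (ev x)
        + od₂ z * od₁ x * d (ev y) + od₂ y * od₁ z * d (ev x) - od₂ y * d (ev z) * od₁ x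
        - od₁ z * od₂ x * d (ev y)) * algebra_three_eq_zero F A
    all_goals
      simp only [ev_lie, od₁_lie, od₂_lie, map_add, map_sub, Derivation.leibniz, smul_eq_mul]
      ring

instance : LieAlgebra F (DoubledWitt d) where
  lie_smul r x y := by
    ext <;> simp [smul_sub, smul_add]

/-- `outerLin` as a derivation. The trace of `T` has to vanish for `T` to preserve the symplectic
form on `F²`. -/
def outer (δ : commutingDerivations d) (T : LieAlgebra.SpecialLinear.sl (Fin 2) F) (z₁ z₂ : A) :
    LieDerivation F (DoubledWitt d) (DoubledWitt d) where
  toLinearMap := outerLin δ T.1 z₁ z₂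
  leibniz' x y := by
    have htr : algebraMap F A (T.1 0 0) + algebraMap F A (T.1 1 1) = 0 := by
      have h : Matrix.trace T.1 = 0 := T.2
      rw [Matrix.trace_fin_two] at h
      rw [← map_add, h, map_zero]
    have hc : ∀ a, δ.1 (d a) = d (δ.1 a) := δ.2
    refine ext ?_ ?_ ?_
    · simp only [map_sub, ev_lie, ev_outerLin, od₁_outerLin, od₂_outerLin, od₁_lie, od₂_lie,
        Algebra.smul_def, Algebra.algebraMap_self, RingHom.id_apply, map_add, Derivation.leibniz,
        hc]
      linear_combination (od₂ x * od₁ y - od₁ x * od₂ y) * htr +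
        (d (ev y) * (od₁ x * z₂ - od₂ x * z₁) + d (ev x) * (od₂ y * z₁ - od₁ y * z₂)) *
          algebra_three_eq_zero F A
    · simp only [map_sub, ev_lie, ev_outerLin, od₁_outerLin, od₁_lie, od₂_lie,
        Algebra.smul_def, Algebra.algebraMap_self, RingHom.id_apply, map_add, Derivation.leibniz,
        Derivation.map_algebraMap, hc]
      ring
    · simp only [map_sub, ev_lie, ev_outerLin, od₂_outerLin, od₁_lie, od₂_lie,
        Algebra.smul_def, Algebra.algebraMap_self, RingHom.id_apply, map_add, Derivation.leibniz,
        Derivation.map_algebraMap, hc]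
      ring

section

variable (δ : commutingDerivations d) (T : LieAlgebra.SpecialLinear.sl (Fin 2) F) (z₁ z₂ : A)
  (x : DoubledWitt d)

@[simp] theorem ev_outer :
    ev (outer δ T z₁ z₂ x) = δ.1 (ev x) + z₁ * od₂ x - z₂ * od₁ x := rfl

@[simp] theorem od₁_outer :
    od₁ (outer δ T z₁ z₂ x) =
      δ.1 (od₁ x) + (T.1 0 0 • od₁ x + T.1 0 1 • od₂ x) - d (ev x * z₁) := rfl

@[simp] theorem od₂_outer :
    od₂ (outer δ T z₁ z₂ x) =
      δ.1 (od₂ x) + (T.1 1 0 • od₁ x + T.1 1 1 • od₂ x) - d (ev x * z₂) := rfl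

end

theorem outer_add (δ δ' : commutingDerivations d) (T T' : LieAlgebra.SpecialLinear.sl (Fin 2) F)
    (z₁ z₂ z₁' z₂' : A) : outer (δ + δ') (T + T') (z₁ + z₁') (z₂ + z₂') =
      outer δ T z₁ z₂ + outer δ' T' z₁' z₂' := by
  refine LieDerivation.ext fun x => ?_
  ext <;> simp [add_smul, mul_add] <;> ring

theorem outer_smul (r : F) (δ : commutingDerivations d)
    (T : LieAlgebra.SpecialLinear.sl (Fin 2) F) (z₁ z₂ : A) :
    outer (r • δ) (r • T) (r • z₁) (r • z₂) = r • outer δ T z₁ z₂ := by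
  refine LieDerivation.ext fun x => ?_
  ext <;> simp [smul_sub, smul_add, smul_smul]

/-- The condition `z₁ z₂' = z₂ z₁'` says that the elements `z₁ ⊗ e₁ + z₂ ⊗ e₂` and
`z₁' ⊗ e₁ + z₂' ⊗ e₂` commute. -/
theorem lie_outer (δ δ' : commutingDerivations d) (T T' : LieAlgebra.SpecialLinear.sl (Fin 2) F)
    (z₁ z₂ z₁' z₂' : A) (hδ : ∀ a, δ.1 (δ'.1 a) = δ'.1 (δ.1 a)) (hz : z₁ * z₂' = z₂ * z₁') :
    ⁅outer δ T z₁ z₂, outer δ' T' z₁' z₂'⁆ = outer 0 ⁅T, T'⁆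
      (δ.1 z₁' - δ'.1 z₁ + (T.1 0 0 • z₁' + T.1 0 1 • z₂') - (T'.1 0 0 • z₁ + T'.1 0 1 • z₂))
      (δ.1 z₂' - δ'.1 z₂ + (T.1 1 0 • z₁' + T.1 1 1 • z₂') - (T'.1 1 0 • z₁ + T'.1 1 1 • z₂)) := by
  have htr : ∀ T : LieAlgebra.SpecialLinear.sl (Fin 2) F,
      algebraMap F A (T.1 1 1) = - algebraMap F A (T.1 0 0) := by
    intro T
    have h : Matrix.trace T.1 = 0 := T.2
    rw [Matrix.trace_fin_two] at h
    rw [eq_neg_iff_add_eq_zero, ← map_add, add_comm, h, map_zero]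
  have hz' := congrArg d hz
  simp only [Derivation.leibniz, smul_eq_mul] at hz'
  have hc : ∀ a, δ.1 (d a) = d (δ.1 a) := δ.2
  have hc' : ∀ a, δ'.1 (d a) = d (δ'.1 a) := δ'.2
  have hT := LieAlgebra.SpecialLinear.sl_bracket (Fin 2) F T T'
  refine LieDerivation.ext fun x => ?_
  rw [LieDerivation.commutator_apply]
  ext
  · simp only [map_sub, ev_outer, od₁_outer, od₂_outer, Algebra.smul_def, Algebra.algebraMap_self,
      RingHom.id_apply, map_add, Derivation.leibniz, hδ, ZeroMemClass.coe_zero,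
      Derivation.zero_apply]
    simp only [htr]
    linear_combination (-1 : A) * ev x * hz' - 2 * d (ev x) * hz
  all_goals
    simp only [map_sub, ev_outer, od₁_outer, od₂_outer, Algebra.smul_def, Algebra.algebraMap_self,
      RingHom.id_apply, map_add, Derivation.leibniz, hδ, hc, hc', hT, Matrix.sub_apply,
      Matrix.mul_apply, Fin.sum_univ_two, map_mul, ZeroMemClass.coe_zero,
      Derivation.zero_apply, Derivation.map_algebraMap]
    simp only [htr]
  · linear_combination od₁ x * hz' + d (od₁ x) * hz
  · linear_combination od₂ x * hz' + d (od₂ x) * hz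

end CharThree

end DoubledWitt

/-! ### Divided powers in one variable -/

namespace DivPow

variable {F : Type*} [Field F] {n : ℕ}

variable (F n) in
/-- The divided power `x^(k)` of the one-variable algebra `O(1; n)`, realized as `O(2; (0, n))`. -/
def X (k : ℕ) : DivPow F 3 0 n := mon (0, k)

theorem X_zero : X F n 0 = 1 := rfl

theorem X_eq_zero {k : ℕ} (h : 3 ^ n ≤ k) : X F n k = 0 :=
  mon_eq_zero _ fun h' => by simp at h'; omega

theorem X_mul_X (a b : ℕ) : X F n a * X F n b = ((a + b).choose b : F) • X F n (a + b) := by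
  simp [X, mon_mul_mon]

theorem hom_ext_X {M : Type*} [AddCommGroup M] [Module F M] {f g : DivPow F 3 0 n →ₗ[F] M}
    (h : ∀ k < 3 ^ n, f (X F n k) = g (X F n k)) : f = g := by
  refine hom_ext fun c hc => ?_
  obtain ⟨i, k⟩ := c
  obtain rfl : i = 0 := by simpa using hc.1
  exact h k hc.2

/-- The linear map with prescribed values on the divided powers. -/
def liftX {M : Type*} [AddCommGroup M] [Module F M] (g : ℕ → M) : DivPow F 3 0 n →ₗ[F] M :=
  lift fun c => g c.2

theorem liftX_X {M : Type*} [AddCommGroup M] [Module F M] (g : ℕ → M) {k : ℕ} (h : k < 3 ^ n) :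
    liftX g (X F n k) = g k :=
  lift_mon _ _ ⟨by simp, h⟩

/-- The coefficient of `x^(k)`. -/
def coeff (k : ℕ) : DivPow F 3 0 n →ₗ[F] F := liftX fun m => if m = k then 1 else 0

theorem coeff_X {k m : ℕ} (h : m < 3 ^ n) : coeff k (X F n m) = if m = k then 1 else 0 :=
  liftX_X _ h

theorem coeff_eq_zero {k : ℕ} (h : 3 ^ n ≤ k) (a : DivPow F 3 0 n) : coeff k a = 0 := by
  have : (coeff k : DivPow F 3 0 n →ₗ[F] F) = 0 := hom_ext_X fun m hm => by
    rw [coeff_X hm, if_neg (by omega), LinearMap.zero_apply]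
  rw [this, LinearMap.zero_apply]

theorem eq_sum_coeff (a : DivPow F 3 0 n) :
    a = ∑ k ∈ Finset.range (3 ^ n), coeff k a • X F n k := by
  have : LinearMap.id = ∑ k ∈ Finset.range (3 ^ n),
      (coeff k : DivPow F 3 0 n →ₗ[F] F).smulRight (X F n k) := hom_ext_X fun m hm => by
    simp [coeff_X hm, hm]
  simpa using congrArg (fun φ => φ a) this

theorem ext_coeff {a b : DivPow F 3 0 n} (h : ∀ k, coeff k a = coeff k b) : a = b := by
  rw [eq_sum_coeff a, eq_sum_coeff b]
  simp [h]

theorem coeff_zero_mul_X (a : DivPow F 3 0 n) {k : ℕ} (hk : 0 < k) :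
    coeff 0 (a * X F n k) = 0 := by
  have : coeff 0 ∘ₗ LinearMap.mulRight F (X F n k) = 0 := hom_ext_X fun m hm => by
    rw [LinearMap.comp_apply, LinearMap.mulRight_apply, X_mul_X, map_smul, LinearMap.zero_apply]
    by_cases h : m + k < 3 ^ n
    · rw [coeff_X h, if_neg (by omega), smul_zero]
    · rw [X_eq_zero (by omega), map_zero, smul_zero]
  exact congrArg (fun φ => φ a) this

theorem coeff_algebraMap (k : ℕ) (r : F) :
    coeff k (algebraMap F (DivPow F 3 0 n) r) = if k = 0 then r else 0 := by
  rw [Algebra.algebraMap_eq_smul_one, ← X_zero, map_smul, coeff_X (by positivity)]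
  simp [eq_comm]

theorem coeff_zero_one : coeff 0 (1 : DivPow F 3 0 n) = 1 := by
  rw [← X_zero, coeff_X (by positivity), if_pos rfl]

variable [CharP F 3]

variable (F n) in
/-- The derivation `d/dx` of `O(1; n)`. -/
def ddx : Derivation F (DivPow F 3 0 n) (DivPow F 3 0 n) := partial₂ F 3 0 n

theorem ddx_X_zero : ddx F n (X F n 0) = 0 := by rw [X_zero, Derivation.map_one_eq_zero]

theorem ddx_X_succ {k : ℕ} (h : k + 1 < 3 ^ n) : ddx F n (X F n (k + 1)) = X F n k := by
  rw [ddx, partial₂_apply, X, partial₂Hom_mon _ ⟨by simp, h⟩]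
  simp [X]

theorem coeff_ddx (k : ℕ) (a : DivPow F 3 0 n) : coeff k (ddx F n a) = coeff (k + 1) a := by
  have : coeff k ∘ₗ (ddx F n : DivPow F 3 0 n →ₗ[F] DivPow F 3 0 n) = coeff (k + 1) :=
      hom_ext_X fun m hm => by
    rw [LinearMap.comp_apply, Derivation.coeFn_coe, coeff_X hm]
    cases m with
    | zero => simp [ddx_X_zero]
    | succ m => rw [ddx_X_succ hm, coeff_X (by omega)]; simp
  exact congrArg (fun φ => φ a) this

theorem eq_algebraMap_of_ddx_eq_zero {a : DivPow F 3 0 n} (h : ddx F n a = 0) :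
    a = algebraMap F _ (coeff 0 a) := by
  refine ext_coeff fun k => ?_
  rw [coeff_algebraMap]
  cases k with
  | zero => simp
  | succ k => rw [← coeff_ddx, h]; simp

theorem coeff_top_ddx (a : DivPow F 3 0 n) : coeff (3 ^ n - 1) (ddx F n a) = 0 := by
  rw [coeff_ddx, coeff_eq_zero]
  omega

/-- The image of `d/dx` is complemented by the span of the top divided power. -/
theorem exists_ddx_add (a : DivPow F 3 0 n) :
    ∃ b, a = ddx F n b + coeff (3 ^ n - 1) a • X F n (3 ^ n - 1) := by
  have h0 : 0 < 3 ^ n := by positivity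
  refine ⟨liftX (fun m => X F n (m + 1)) a, ?_⟩
  have : LinearMap.id = (ddx F n : DivPow F 3 0 n →ₗ[F] DivPow F 3 0 n) ∘ₗ
      liftX (fun m => X F n (m + 1)) +
      (coeff (3 ^ n - 1)).smulRight (X F n (3 ^ n - 1)) := hom_ext_X fun m hm => by
    simp only [LinearMap.id_apply, LinearMap.add_apply, LinearMap.comp_apply,
      Derivation.coeFn_coe, liftX_X _ hm, LinearMap.smulRight_apply, coeff_X hm]
    by_cases h : m + 1 < 3 ^ n
    · rw [ddx_X_succ h, if_neg (by omega), zero_smul, add_zero]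
    · obtain rfl : m = 3 ^ n - 1 := by omega
      rw [X_eq_zero (k := 3 ^ n - 1 + 1) (by omega), if_pos rfl, map_zero, one_smul, zero_add]
  exact congrArg (fun φ => φ a) this

theorem ddx_X_one (hn : 1 < n) : ddx F n (X F n 1) = 1 :=
  ddx_X_succ (one_lt_pow₀ (by norm_num) (by omega))

/-- A linear endomorphism `δ` commuting with `d/dx` is determined by the constant terms of the
`δ(x^(k))`, because the coefficient of `x^(k)` in `δ a` is the constant term of
`(d/dx)^k (δ a) = δ ((d/dx)^k a)`. -/
theorem eq_of_commute_ddx {δ δ' : DivPow F 3 0 n →ₗ[F] DivPow F 3 0 n}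
    (h : ∀ a, δ (ddx F n a) = ddx F n (δ a)) (h' : ∀ a, δ' (ddx F n a) = ddx F n (δ' a))
    (h0 : ∀ k < 3 ^ n, coeff 0 (δ (X F n k)) = coeff 0 (δ' (X F n k))) : δ = δ' := by
  have h1 : coeff 0 ∘ₗ δ = coeff 0 ∘ₗ δ' := hom_ext_X h0
  have key : ∀ k a, coeff k (δ a) = coeff k (δ' a) := by
    intro k
    induction k with
    | zero => exact fun a => congrArg (fun φ => φ a) h1
    | succ k ih => intro a; rw [← coeff_ddx, ← coeff_ddx, ← h, ← h', ih]
  exact LinearMap.ext fun a => ext_coeff fun k => key k a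

end DivPow

/-- The third power of a derivation of an algebra in characteristic three. -/
def Derivation.cube {F A : Type*} [Field F] [CharP F 3] [CommRing A] [Algebra F A]
    (D : Derivation F A A) : Derivation F A A :=
  Derivation.mk' ((D : A →ₗ[F] A) ∘ₗ (D : A →ₗ[F] A) ∘ₗ (D : A →ₗ[F] A)) fun a b => by
    simp only [LinearMap.comp_apply, Derivation.coeFn_coe, Derivation.leibniz, map_add,
      smul_eq_mul]
    linear_combination (D a * D (D b) + D (D a) * D b) * algebra_three_eq_zero F A

namespace DivPow

variable {F : Type*} [Field F] {n : ℕ} [CharP F 3]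

variable (F n) in
/-- The derivation `(d/dx)^(3^j)`. -/
def ddxPow : ℕ → Derivation F (DivPow F 3 0 n) (DivPow F 3 0 n)
  | 0 => ddx F n
  | j + 1 => (ddxPow j).cube

theorem ddxPow_apply (j : ℕ) (a : DivPow F 3 0 n) : ddxPow F n j a = (ddx F n)^[3 ^ j] a := by
  induction j generalizing a with
  | zero => simp [ddxPow]
  | succ j ih =>
    rw [pow_succ, Function.iterate_mul, ← show ⇑(ddxPow F n j) = (ddx F n)^[3 ^ j] from funext ih]
    rfl

theorem coeff_ddxPow (j k : ℕ) (a : DivPow F 3 0 n) :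
    coeff k (ddxPow F n j a) = coeff (k + 3 ^ j) a := by
  rw [ddxPow_apply]
  generalize 3 ^ j = m
  induction m generalizing k a with
  | zero => simp
  | succ m ih => rw [Function.iterate_succ_apply', coeff_ddx, ih, add_right_comm, add_assoc]

variable (n) in
/-- The derivation `∑ c_j (d/dx)^(3^(j+1))`, depending linearly on the coefficients. The exponent
`3^0` is left out because `d/dx` itself induces an inner derivation. -/
def ddxPowSum : AbelianLie F (n - 1) →ₗ[F] Derivation F (DivPow F 3 0 n) (DivPow F 3 0 n) where
  toFun c := ∑ j : Fin (n - 1), c j • ddxPow F n (j + 1)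
  map_add' c c' := by
    rw [← Finset.sum_add_distrib]
    exact Finset.sum_congr rfl fun j _ => add_smul (c j) (c' j) _
  map_smul' r c := by
    rw [RingHom.id_apply, Finset.smul_sum]
    exact Finset.sum_congr rfl fun j _ => mul_smul r (c j) _

theorem coeff_ddxPowSum (c : AbelianLie F (n - 1)) (k : ℕ) (a : DivPow F 3 0 n) :
    coeff k (ddxPowSum n c a) = ∑ j, c j * coeff (k + 3 ^ (j.1 + 1)) a := by
  have : ddxPowSum n c a = ∑ i, c i • ddxPow F n (i.1 + 1) a := by
    change (∑ i, c i • ddxPow F n (i.1 + 1)) a = _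
    rw [← Derivation.coeFnAddMonoidHom_apply, map_sum, Finset.sum_apply]
    rfl
  rw [this, map_sum]
  simp [coeff_ddxPow]

theorem ddxPowSum_comm_ddx (c : AbelianLie F (n - 1)) (a : DivPow F 3 0 n) :
    ddxPowSum n c (ddx F n a) = ddx F n (ddxPowSum n c a) :=
  ext_coeff fun k => by simp only [coeff_ddxPowSum, coeff_ddx, add_right_comm]

theorem ddxPowSum_comm (c c' : AbelianLie F (n - 1)) (a : DivPow F 3 0 n) :
    ddxPowSum n c (ddxPowSum n c' a) = ddxPowSum n c' (ddxPowSum n c a) :=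
  ext_coeff fun k => by
    simp only [coeff_ddxPowSum, Finset.mul_sum]
    rw [Finset.sum_comm]
    refine Finset.sum_congr rfl fun i _ => Finset.sum_congr rfl fun j _ => ?_
    rw [add_right_comm]; ring

end DivPow

/-! ### Outer derivations of the model -/

namespace DivPow

open DoubledWitt

variable {F : Type*} [Field F] {n : ℕ} [CharP F 3]

omit [CharP F 3] in
theorem lieDerivation_ad_apply {L : Type*} [LieRing L] [LieAlgebra F L] (x y : L) :
    LieDerivation.ad F L x y = ⁅x, y⁆ := by simp

variable (F n) in
/-- The outer derivations of the model, linearly parametrized by `(sl₂ ⋉ F²) × F^(n-1)`: the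
vector `v ∈ F²` acts by the bracket with `x^(3^n-1) ⊗ v`, which is not an element of the model. -/
def outerRep : (Sl₂SemidirectV₂ F × AbelianLie F (n - 1)) →ₗ[F]
    LieDerivation F (DoubledWitt (ddx F n)) (DoubledWitt (ddx F n)) where
  toFun s := outer ⟨ddxPowSum n s.2, ddxPowSum_comm_ddx s.2⟩ s.1.right
    (s.1.left 0 • X F n (3 ^ n - 1)) (s.1.left 1 • X F n (3 ^ n - 1))
  map_add' s t := by
    rw [← outer_add, ← add_smul, ← add_smul]
    congr 1
    exact Subtype.ext (map_add (ddxPowSum n) s.2 t.2)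
  map_smul' r s := by
    rw [RingHom.id_apply, ← outer_smul, smul_smul, smul_smul]
    congr 1
    exact Subtype.ext (map_smul (ddxPowSum n) r s.2)

theorem outerRep_apply (s : Sl₂SemidirectV₂ F × AbelianLie F (n - 1)) :
    outerRep F n s = outer ⟨ddxPowSum n s.2, ddxPowSum_comm_ddx s.2⟩ s.1.right
    (s.1.left 0 • X F n (3 ^ n - 1)) (s.1.left 1 • X F n (3 ^ n - 1)) := rfl

/-- The derivations `(d/dx)^(3^j)`, `j > 0`, move the top divided power into the image of `d/dx`;
this makes their commutators with the brackets by `x^(3^n-1) ⊗ v` inner. -/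
theorem ddxPowSum_top (c : AbelianLie F (n - 1)) :
    ∃ b, ddx F n b = ddxPowSum n c (X F n (3 ^ n - 1)) := by
  obtain ⟨b, hb⟩ := exists_ddx_add (ddxPowSum n c (X F n (3 ^ n - 1)))
  refine ⟨b, ?_⟩
  rw [hb, coeff_ddxPowSum, Finset.sum_eq_zero, zero_smul, add_zero]
  intro j _
  rw [coeff_eq_zero, mul_zero]
  have : 0 < 3 ^ (j.1 + 1) := by positivity
  omega

omit [CharP F 3] in
theorem X_top_mul_X_top (hn : 1 < n) : X F n (3 ^ n - 1) * X F n (3 ^ n - 1) = 0 := by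
  have : 3 ^ 1 < 3 ^ n := Nat.pow_lt_pow_right (by norm_num) hn
  rw [X_mul_X, X_eq_zero (by omega), smul_zero]

/-- `outerRep` respects brackets up to inner derivations. -/
theorem lie_outerRep (hn : 1 < n) (s t : Sl₂SemidirectV₂ F × AbelianLie F (n - 1)) :
    ∃ y, ⁅outerRep F n s, outerRep F n t⁆ = outerRep F n ⁅s, t⁆ + LieDerivation.ad F _ y := by
  obtain ⟨b, hb⟩ := ddxPowSum_top (n := n) s.2
  obtain ⟨b', hb'⟩ := ddxPowSum_top (n := n) t.2
  refine ⟨mk _ 0 (t.1.left 0 • b - s.1.left 0 • b') (t.1.left 1 • b - s.1.left 1 • b'), ?_⟩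
  rw [outerRep_apply, outerRep_apply, lie_outer, outerRep_apply]
  rotate_left
  · exact ddxPowSum_comm _ _
  · simp [X_top_mul_X_top hn]
  have hmv : ∀ (M : Matrix (Fin 2) (Fin 2) F) (v : Fin 2 → F) (i : Fin 2),
      M.mulVec v i = M i 0 * v 0 + M i 1 * v 1 := fun M v i => by
    simp [Matrix.mulVec, dotProduct, Fin.sum_univ_two]
  have h0 : (⁅s, t⁆).2 = 0 := rfl
  have hr : (⁅s, t⁆).1.right = ⁅s.1.right, t.1.right⁆ := rfl
  have hl0 : (⁅s, t⁆).1.left 0 = s.1.right.1 0 0 * t.1.left 0 + s.1.right.1 0 1 * t.1.left 1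
      - (t.1.right.1 0 0 * s.1.left 0 + t.1.right.1 0 1 * s.1.left 1) := by
    have : (⁅s, t⁆).1.left 0 = 0 + s.1.right.1.mulVec t.1.left 0
      - t.1.right.1.mulVec s.1.left 0 := rfl
    exact this.trans ((congrArg₂ (fun a b => 0 + a - b) (hmv _ _ 0) (hmv _ _ 0)).trans (by ring))
  have hl1 : (⁅s, t⁆).1.left 1 = s.1.right.1 1 0 * t.1.left 0 + s.1.right.1 1 1 * t.1.left 1
      - (t.1.right.1 1 0 * s.1.left 0 + t.1.right.1 1 1 * s.1.left 1) := by
    have : (⁅s, t⁆).1.left 1 = 0 + s.1.right.1.mulVec t.1.left 1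
      - t.1.right.1.mulVec s.1.left 1 := rfl
    exact this.trans ((congrArg₂ (fun a b => 0 + a - b) (hmv _ _ 1) (hmv _ _ 1)).trans (by ring))
  have h0' : ddxPowSum n (⁅s, t⁆).2 = 0 := by rw [h0]; exact map_zero _
  refine LieDerivation.ext fun x => ?_
  rw [LieDerivation.add_apply, lieDerivation_ad_apply]
  ext
  · simp only [ev_outer, map_add, ev_lie, ev_mk, od₁_mk, od₂_mk, h0', map_sub, Derivation.map_smul,
      hb, hb', hl0, hl1, hr, ZeroMemClass.coe_zero, Derivation.zero_apply, map_zero]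
    simp only [Algebra.smul_def, map_sub, map_add, map_mul]
    ring
  · simp only [od₁_outer, map_add, od₁_lie, ev_mk, od₁_mk, h0', map_sub,
      Derivation.map_smul, hb, hb', hl0, hl1, hr, ZeroMemClass.coe_zero, Derivation.zero_apply,
      map_zero, zero_mul, sub_smul, add_smul, mul_smul, mul_add, mul_sub]
    ring
  · simp only [od₂_outer, map_add, od₂_lie, ev_mk, od₂_mk, h0', map_sub,
      Derivation.map_smul, hb, hb', hl0, hl1, hr, ZeroMemClass.coe_zero, Derivation.zero_apply,
      map_zero, zero_mul, sub_smul, add_smul, mul_smul, mul_add, mul_sub]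
    ring

/-- No nonzero value of `outerRep` is inner: if one is equal to `ad y`, its values on `1`, on the
constants in `dA ⊗ F²`, on `x` and on the `x^(3^j)` show in turn that `v`, `T`, `y` and `c`
vanish. -/
theorem eq_zero_of_outerRep_eq_ad (hn : 1 < n) (s : Sl₂SemidirectV₂ F × AbelianLie F (n - 1))
    (y : DoubledWitt (ddx F n)) (h : outerRep F n s = LieDerivation.ad F _ y) : s = 0 := by
  have h9 : 3 ^ 2 ≤ 3 ^ n := Nat.pow_le_pow_right (by norm_num) hn
  have h' : ∀ x, outer ⟨ddxPowSum n s.2, ddxPowSum_comm_ddx s.2⟩ s.1.right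
    (s.1.left 0 • X F n (3 ^ n - 1)) (s.1.left 1 • X F n (3 ^ n - 1)) x = ⁅y, x⁆ := fun x => by
    rw [← outerRep_apply, h, lieDerivation_ad_apply]
  have hd1 : ddx F n (X F n 1) = 1 := ddx_X_succ (by omega)
  have hsc : ∀ r : F, r • (1 : DivPow F 3 0 n) = 0 → r = 0 := fun r hr => by
    simpa [coeff_zero_one] using congrArg (coeff 0) hr
  obtain ⟨f, hf⟩ := exists_od₁ y
  obtain ⟨g, hg⟩ := exists_od₂ y
  have htop : ∀ (r : F) (b : DivPow F 3 0 n),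
      ddx F n (r • X F n (3 ^ n - 1)) = ddx F n (ddx F n b) → r = 0 := fun r b hb => by
    have := congrArg (coeff (3 ^ n - 2)) hb
    rw [coeff_ddx, coeff_ddx, show 3 ^ n - 2 + 1 = 3 ^ n - 1 by omega, coeff_top_ddx, map_smul,
      coeff_X (by omega), if_pos rfl] at this
    simpa using this
  have e := h' (mk _ 1 0 0)
  have ey : ddx F n (ev y) = 0 := by simpa using congrArg ev e
  have hv0 : s.1.left 0 = 0 := htop _ f (by simpa [hf] using congrArg od₁ e)
  have hv1 : s.1.left 1 = 0 := htop _ g (by simpa [hg] using congrArg od₂ e)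
  have eo₁ := h' (mk _ 0 (X F n 1) 0)
  have eo₂ := h' (mk _ 0 0 (X F n 1))
  have hy₂ : od₂ y = 0 := by simpa [hd1, hv1] using congrArg ev eo₁
  have hy₁ : od₁ y = 0 := Eq.symm <| by simpa [hd1, hv0] using congrArg ev eo₂
  have hT : s.1.right = 0 := by
    refine Subtype.ext (Matrix.ext fun i j => ?_)
    fin_cases i <;> fin_cases j
    · exact hsc _ (by simpa [hd1, ey] using congrArg od₁ eo₁)
    · exact hsc _ (by simpa [hd1, ey] using congrArg od₁ eo₂)
    · exact hsc _ (by simpa [hd1, ey] using congrArg od₂ eo₁)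
    · exact hsc _ (by simpa [hd1, ey] using congrArg od₂ eo₂)
  have ex := congrArg ev (h' (mk _ (X F n 1) 0 0))
  have hy : ev y = 0 := by
    rw [eq_algebraMap_of_ddx_eq_zero ey]
    have := congrArg (coeff 0) ex
    simp only [ev_outer, ev_lie, ev_mk, od₁_mk, od₂_mk, map_zero, hd1, ey, mul_zero, mul_one,
      zero_mul, sub_zero, add_zero, coeff_ddxPowSum] at this
    rw [← this, Finset.sum_eq_zero, map_zero]
    intro j _
    have : 3 ^ (j.1 + 1) = 3 * 3 ^ j.1 := by ring
    rw [coeff_X (by omega), if_neg (by omega), mul_zero]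
  have hc : s.2 = 0 := by
    refine funext fun j => ?_
    have hj : 3 ^ (j.1 + 1) < 3 ^ n := Nat.pow_lt_pow_right (by norm_num) (by omega)
    have := congrArg (coeff 0) (congrArg ev (h' (mk _ (X F n (3 ^ (j.1 + 1))) 0 0)))
    simp only [ev_outer, ev_lie, ev_mk, od₁_mk, od₂_mk, map_zero, hy, mul_zero,
      zero_mul, sub_zero, add_zero, coeff_ddxPowSum] at this
    rw [Finset.sum_eq_single j] at this
    · refine Eq.trans ?_ (this.trans rfl)
      simp [coeff_X hj]
    · intro i _ hij
      rw [coeff_X hj, if_neg, mul_zero]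
      rw [zero_add]
      intro h
      have := Nat.pow_right_injective (le_refl 3 |>.trans' (by norm_num)) h
      exact hij (Fin.ext (by omega))
    · simp
  have hv : s.1.left = 0 := funext fun i => by fin_cases i; exacts [hv0, hv1]
  exact Prod.ext (LieAlgebra.SemiDirectSum.ext hv hT) hc

/-! ### Normalization of a derivation of the model -/

/-- A nonzero multiple of the top divided power cannot be the value of a derivation at `1`: apply
the derivation to `[1, 1 ⊗ e₁] = 0`, and compare coefficients of `x^(3^n-2)`. -/
theorem apply_mk_one_eq_zero (D : LieDerivation F (DoubledWitt (ddx F n)) (DoubledWitt (ddx F n)))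
    (hn : 1 < n) {l : F}
    (h : D (mk (ddx F n) 1 0 0) = mk (ddx F n) (l • X F n (3 ^ n - 1)) 0 0) :
    D (mk (ddx F n) 1 0 0) = 0 := by
  have h9 : 3 ^ 2 ≤ 3 ^ n := Nat.pow_le_pow_right (by norm_num) hn
  have hb : ⁅mk (ddx F n) 1 0 0, mk (ddx F n) 0 (X F n 1) 0⁆ = 0 := by
    ext <;> simp [ddx_X_one hn]
  obtain ⟨f, hf⟩ := exists_od₁ (D (mk (ddx F n) 0 (X F n 1) 0))
  have := congrArg (coeff (3 ^ n - 2)) (congrArg od₁ (congrArg D hb))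
  rw [LieDerivation.apply_lie_eq_add, h, map_add, od₁_lie, od₁_lie] at this
  simp only [ev_mk, od₁_mk, ddx_X_one hn, ← hf, map_zero, mul_zero, sub_zero, mul_one, one_mul,
    map_add, coeff_ddx] at this
  rw [coeff_eq_zero (k := 3 ^ n - 2 + 1 + 1) (by omega), show 3 ^ n - 2 + 1 = 3 ^ n - 1 by omega,
    map_smul, coeff_X (by omega), if_pos rfl, zero_add, smul_eq_mul, mul_one] at this
  rw [h, this, zero_smul]
  ext <;> simp

/-- Modulo inner derivations and brackets with `x^(3^n-1) ⊗ v`, every derivation kills `1`. -/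
theorem exists_sub_apply_mk_one
    (D : LieDerivation F (DoubledWitt (ddx F n)) (DoubledWitt (ddx F n))) (hn : 1 < n) :
    ∃ s y, (D - outerRep F n s - LieDerivation.ad F (DoubledWitt (ddx F n)) y)
      (mk (ddx F n) 1 0 0) = 0 := by
  obtain ⟨f, hf⟩ := exists_od₁ (D (mk (ddx F n) 1 0 0))
  obtain ⟨g, hg⟩ := exists_od₂ (D (mk (ddx F n) 1 0 0))
  obtain ⟨b, hb⟩ := exists_ddx_add (ev (D (mk (ddx F n) 1 0 0)))
  obtain ⟨f', hf'⟩ := exists_ddx_add f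
  obtain ⟨g', hg'⟩ := exists_ddx_add g
  let s : Sl₂SemidirectV₂ F × AbelianLie F (n - 1) :=
    (⟨![-coeff (3 ^ n - 1) f, -coeff (3 ^ n - 1) g], 0⟩, 0)
  refine ⟨s, mk (ddx F n) (-b) (-f') (-g'),
    apply_mk_one_eq_zero _ hn (l := coeff (3 ^ n - 1) (ev (D (mk (ddx F n) 1 0 0)))) ?_⟩
  have hs0 : s.1.left 0 = -coeff (3 ^ n - 1) f := rfl
  have hs1 : s.1.left 1 = -coeff (3 ^ n - 1) g := rfl
  have hr : s.1.right = 0 := rfl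
  rw [LieDerivation.sub_apply, LieDerivation.sub_apply, lieDerivation_ad_apply, outerRep_apply]
  ext
  · simp only [map_sub, ev_outer, ev_lie, ev_mk, od₁_mk, od₂_mk, map_zero]
    nth_rewrite 1 [hb]
    simp
  · simp only [map_sub, od₁_outer, od₁_lie, ev_mk, od₁_mk, od₂_mk, map_zero, ← hf, hs0, hr]
    nth_rewrite 1 [hf']
    simp
  · simp only [map_sub, od₂_outer, od₂_lie, ev_mk, od₁_mk, od₂_mk, map_zero, ← hg, hs1, hr]
    nth_rewrite 1 [hg']
    simp

/-- A derivation that kills `1` commutes with `[1, ·]`, which is `d/dx` on each component. -/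
theorem ddx_apply_eq_zero {D : LieDerivation F (DoubledWitt (ddx F n)) (DoubledWitt (ddx F n))}
    (he : D (mk (ddx F n) 1 0 0) = 0) {y : DoubledWitt (ddx F n)}
    (hy : D ⁅mk (ddx F n) 1 0 0, y⁆ = 0) :
    ddx F n (ev (D y)) = 0 ∧ ddx F n (od₁ (D y)) = 0 ∧ ddx F n (od₂ (D y)) = 0 := by
  rw [LieDerivation.apply_lie_eq_add, he, zero_lie, add_zero] at hy
  exact ⟨by simpa using congrArg ev hy, by simpa using congrArg od₁ hy,
    by simpa using congrArg od₂ hy⟩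

theorem lie_one_odd₁ (hn : 1 < n) : ⁅mk (ddx F n) 1 0 0, mk (ddx F n) 0 (X F n 1) 0⁆ = 0 := by
  ext <;> simp [ddx_X_one hn]

theorem lie_one_odd₂ (hn : 1 < n) : ⁅mk (ddx F n) 1 0 0, mk (ddx F n) 0 0 (X F n 1)⁆ = 0 := by
  ext <;> simp [ddx_X_one hn]

/-- A derivation that kills `1` acts on the constants `1 ⊗ F²` by a matrix, up to values in `A`. Its
trace is zero because `[1 ⊗ e₁, 1 ⊗ e₂] = 1`. -/
theorem exists_sub_apply_odd
    {D : LieDerivation F (DoubledWitt (ddx F n)) (DoubledWitt (ddx F n))} (hn : 1 < n)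
    (he : D (mk (ddx F n) 1 0 0) = 0) :
    ∃ s, (D - outerRep F n s) (mk (ddx F n) 1 0 0) = 0 ∧
      od₁ ((D - outerRep F n s) (mk (ddx F n) 0 (X F n 1) 0)) = 0 ∧
      od₂ ((D - outerRep F n s) (mk (ddx F n) 0 (X F n 1) 0)) = 0 ∧
      od₁ ((D - outerRep F n s) (mk (ddx F n) 0 0 (X F n 1))) = 0 ∧
      od₂ ((D - outerRep F n s) (mk (ddx F n) 0 0 (X F n 1))) = 0 := by
  have hd1 := ddx_X_one (F := F) hn
  obtain ⟨-, h1, h2⟩ := ddx_apply_eq_zero he (y := mk (ddx F n) 0 (X F n 1) 0)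
    (by rw [lie_one_odd₁ hn, map_zero])
  obtain ⟨-, h3, h4⟩ := ddx_apply_eq_zero he (y := mk (ddx F n) 0 0 (X F n 1))
    (by rw [lie_one_odd₂ hn, map_zero])
  replace h1 := eq_algebraMap_of_ddx_eq_zero h1
  replace h2 := eq_algebraMap_of_ddx_eq_zero h2
  replace h3 := eq_algebraMap_of_ddx_eq_zero h3
  replace h4 := eq_algebraMap_of_ddx_eq_zero h4
  have hb : ⁅mk (ddx F n) 0 (X F n 1) 0, mk (ddx F n) 0 0 (X F n 1)⁆ = mk (ddx F n) 1 0 0 := by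
    ext <;> simp [hd1]
  have htr : coeff 0 (od₁ (D (mk (ddx F n) 0 (X F n 1) 0))) +
      coeff 0 (od₂ (D (mk (ddx F n) 0 0 (X F n 1)))) = 0 := by
    have := congrArg ev (congrArg D hb)
    rw [LieDerivation.apply_lie_eq_add, he] at this
    have := congrArg (coeff 0) this
    simp only [map_add, ev_lie, ev_mk, od₁_mk, od₂_mk, hd1, map_zero, zero_mul, mul_zero, one_mul,
      mul_one, sub_zero, zero_add] at this
    rw [add_comm]
    exact this
  refine ⟨(⟨0, ⟨!![coeff 0 (od₁ (D (mk (ddx F n) 0 (X F n 1) 0))),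
    coeff 0 (od₁ (D (mk (ddx F n) 0 0 (X F n 1)))); coeff 0 (od₂ (D (mk (ddx F n) 0 (X F n 1) 0))),
    coeff 0 (od₂ (D (mk (ddx F n) 0 0 (X F n 1))))], ?_⟩⟩, 0), ?_⟩
  · change Matrix.trace (!![_, _; _, _] : Matrix (Fin 2) (Fin 2) F) = 0
    exact (Matrix.trace_fin_two_of _ _ _ _).trans htr
  have hv : ∀ i, (0 : AbelianLie F 2) i = 0 := fun _ => rfl
  have hc := map_zero (ddxPowSum (F := F) n)
  simp only [LieDerivation.sub_apply, he, outerRep_apply, map_sub, od₁_outer, od₂_outer, ev_mk,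
    od₁_mk, od₂_mk, hd1, hc, hv, Derivation.zero_apply, map_zero, smul_zero, zero_mul]
  refine ⟨?_, ?_, ?_, ?_, ?_⟩
  · ext <;> simp
  · rw [sub_eq_zero, h1]; simp [Algebra.algebraMap_eq_smul_one, coeff_zero_one]
  · rw [sub_eq_zero, h2]; simp [Algebra.algebraMap_eq_smul_one, coeff_zero_one]
  · rw [sub_eq_zero, h3]; simp [Algebra.algebraMap_eq_smul_one, coeff_zero_one]
  · rw [sub_eq_zero, h4]; simp [Algebra.algebraMap_eq_smul_one, coeff_zero_one]

/-- The remaining values on `1 ⊗ F²` and the value on `x` are constants. They are those of an inner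
derivation: `[x, 1 ⊗ v] = 1 ⊗ v` relates them, and `-2 = 1`. -/
theorem exists_sub_ad_apply
    {D : LieDerivation F (DoubledWitt (ddx F n)) (DoubledWitt (ddx F n))} (hn : 1 < n)
    (he : D (mk (ddx F n) 1 0 0) = 0)
    (h₁₁ : od₁ (D (mk (ddx F n) 0 (X F n 1) 0)) = 0)
    (h₂₁ : od₂ (D (mk (ddx F n) 0 (X F n 1) 0)) = 0)
    (h₁₂ : od₁ (D (mk (ddx F n) 0 0 (X F n 1))) = 0)
    (h₂₂ : od₂ (D (mk (ddx F n) 0 0 (X F n 1))) = 0) :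
    ∃ y, (D - LieDerivation.ad F (DoubledWitt (ddx F n)) y) (mk (ddx F n) 1 0 0) = 0 ∧
      (D - LieDerivation.ad F (DoubledWitt (ddx F n)) y) (mk (ddx F n) (X F n 1) 0 0) = 0 ∧
      (D - LieDerivation.ad F (DoubledWitt (ddx F n)) y) (mk (ddx F n) 0 (X F n 1) 0) = 0 ∧
      (D - LieDerivation.ad F (DoubledWitt (ddx F n)) y) (mk (ddx F n) 0 0 (X F n 1)) = 0 := by
  have hd1 := ddx_X_one (F := F) hn
  have h3 := algebra_three_eq_zero F (DivPow F 3 0 n)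
  obtain ⟨a1, -, -⟩ := ddx_apply_eq_zero he (y := mk (ddx F n) 0 (X F n 1) 0)
    (by rw [lie_one_odd₁ hn, map_zero])
  obtain ⟨a2, -, -⟩ := ddx_apply_eq_zero he (y := mk (ddx F n) 0 0 (X F n 1))
    (by rw [lie_one_odd₂ hn, map_zero])
  obtain ⟨b0, b1, b2⟩ := ddx_apply_eq_zero he (y := mk (ddx F n) (X F n 1) 0 0) (by
    have : ⁅mk (ddx F n) 1 0 0, mk (ddx F n) (X F n 1) 0 0⁆ = mk (ddx F n) 1 0 0 := by
      ext <;> simp [hd1]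
    rw [this, he])
  have c1 : ⁅mk (ddx F n) (X F n 1) 0 0, mk (ddx F n) 0 (X F n 1) 0⁆ =
      mk (ddx F n) 0 (X F n 1) 0 := by
    ext <;> simp [hd1]
  have c2 : ⁅mk (ddx F n) (X F n 1) 0 0, mk (ddx F n) 0 0 (X F n 1)⁆ =
      mk (ddx F n) 0 0 (X F n 1) := by
    ext <;> simp [hd1]
  obtain ⟨f, hf⟩ := exists_od₁ (D (mk (ddx F n) (X F n 1) 0 0))
  obtain ⟨g, hg⟩ := exists_od₂ (D (mk (ddx F n) (X F n 1) 0 0))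
  have e1 := congrArg ev (congrArg D c1)
  have e2 := congrArg ev (congrArg D c2)
  rw [LieDerivation.apply_lie_eq_add] at e1 e2
  simp only [map_add, ev_lie, ev_mk, od₁_mk, od₂_mk, hd1, a1, a2, map_zero, mul_zero, zero_mul,
    mul_one, one_mul, ← hf, ← hg] at e1 e2
  rw [← hf] at b1
  rw [← hg] at b2
  refine ⟨mk (ddx F n) (ev (D (mk (ddx F n) (X F n 1) 0 0))) (-f) (-g), ?_, ?_, ?_, ?_⟩ <;>
    rw [LieDerivation.sub_apply, lieDerivation_ad_apply]
  · rw [he]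
    ext <;> simp [b0, b1, b2]
  · ext
    · simp [b0, hd1]
    · simp [b1, hd1, ← hf]
    · simp [b2, hd1, ← hg]
  · ext
    · simp only [map_sub, ev_lie, ev_mk, od₁_mk, od₂_mk, hd1, map_neg, map_zero]
      linear_combination e1 + ev (D (mk (ddx F n) 0 (X F n 1) 0)) * h3
    · simp [h₁₁, b0, hd1]
    · simp [h₂₁]
  · ext
    · simp only [map_sub, ev_lie, ev_mk, od₁_mk, od₂_mk, hd1, map_neg, map_zero]
      linear_combination e2 + ev (D (mk (ddx F n) 0 0 (X F n 1))) * h3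
    · simp [h₁₂]
    · simp [h₂₂, b0, hd1]

/-! ### Derivations that vanish on `1`, on `1 ⊗ F²` and on `x` -/

section Normalized

variable {D : LieDerivation F (DoubledWitt (ddx F n)) (DoubledWitt (ddx F n))} (hn : 1 < n)
  (he : D (mk (ddx F n) 1 0 0) = 0) (h₁ : D (mk (ddx F n) 0 (X F n 1) 0) = 0)
  (h₂ : D (mk (ddx F n) 0 0 (X F n 1)) = 0)

include he in
theorem apply_lie_one (y : DoubledWitt (ddx F n)) :
    D ⁅mk (ddx F n) 1 0 0, y⁆ = ⁅mk (ddx F n) 1 0 0, D y⁆ := by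
  rw [LieDerivation.apply_lie_eq_add, he, zero_lie, add_zero]

include hn h₁ h₂ in
/-- This follows from `[1 ⊗ v, [1 ⊗ v, a]] = 0`. -/
theorem ddx_odd_apply_even (a : DivPow F 3 0 n) :
    ddx F n (od₁ (D (mk (ddx F n) a 0 0))) = 0 ∧ ddx F n (od₂ (D (mk (ddx F n) a 0 0))) = 0 := by
  have hd1 := ddx_X_one (F := F) hn
  constructor
  · have : ⁅mk (ddx F n) 0 0 (X F n 1), ⁅mk (ddx F n) 0 0 (X F n 1), mk (ddx F n) a 0 0⁆⁆ = 0 := by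
      ext <;> simp
    have := congrArg D this
    rw [LieDerivation.apply_lie_eq_add, LieDerivation.apply_lie_eq_add, h₂, zero_lie, zero_lie,
      add_zero, add_zero, map_zero] at this
    simpa [hd1] using congrArg od₂ this
  · have : ⁅mk (ddx F n) 0 (X F n 1) 0, ⁅mk (ddx F n) 0 (X F n 1) 0, mk (ddx F n) a 0 0⁆⁆ = 0 := by
      ext <;> simp
    have := congrArg D this
    rw [LieDerivation.apply_lie_eq_add, LieDerivation.apply_lie_eq_add, h₁, zero_lie, zero_lie,
      add_zero, add_zero, map_zero] at this
    simpa [hd1] using congrArg od₁ this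

include hn he h₁ h₂ in
/-- The even part `A` is preserved. By the previous lemma the component in `dA ⊗ F²` is a constant
which vanishes on the image of `d/dx`. It vanishes on the top divided power `X` because of
`[x^(2), X] = 0`; here `x^(2)` lies in the image of `d/dx` since `n > 1`. -/
theorem odd_apply_even (a : DivPow F 3 0 n) :
    od₁ (D (mk (ddx F n) a 0 0)) = 0 ∧ od₂ (D (mk (ddx F n) a 0 0)) = 0 := by
  have h9 : 3 ^ 2 ≤ 3 ^ n := Nat.pow_le_pow_right (by norm_num) hn
  -- On the image of `d/dx` the component is a derivative of a constant.
  have hd : ∀ b, od₁ (D (mk (ddx F n) (ddx F n b) 0 0)) = 0 ∧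
      od₂ (D (mk (ddx F n) (ddx F n b) 0 0)) = 0 := fun b => by
    have hb : mk (ddx F n) (ddx F n b) 0 0 = ⁅mk (ddx F n) 1 0 0, mk (ddx F n) b 0 0⁆ := by
      ext <;> simp
    obtain ⟨e1, e2⟩ := ddx_odd_apply_even hn h₁ h₂ b
    rw [hb, apply_lie_one he]
    constructor
    · simpa using e1
    · simpa using e2
  obtain ⟨o1, o2⟩ := hd (X F n 3)
  rw [ddx_X_succ (by omega)] at o1 o2
  have htop : od₁ (D (mk (ddx F n) (X F n (3 ^ n - 1)) 0 0)) = 0 ∧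
      od₂ (D (mk (ddx F n) (X F n (3 ^ n - 1)) 0 0)) = 0 := by
    obtain ⟨e1, e2⟩ := ddx_odd_apply_even hn h₁ h₂ (X F n (3 ^ n - 1))
    have hb : ⁅mk (ddx F n) (X F n 2) 0 0, mk (ddx F n) (X F n (3 ^ n - 1)) 0 0⁆ = 0 := by
      have hN : 3 ^ n - 1 = 3 ^ n - 2 + 1 := by omega
      have e1 : X F n 2 * X F n (3 ^ n - 2) = 0 := by
        rw [X_mul_X, X_eq_zero (by omega), smul_zero]
      have e2 : X F n 1 * X F n (3 ^ n - 1) = 0 := by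
        rw [X_mul_X, X_eq_zero (by omega), smul_zero]
      ext
      · simp only [ev_lie, ev_mk, od₁_mk, od₂_mk, map_zero]
        rw [hN, ddx_X_succ (by omega), ddx_X_succ (by omega), e1, ← hN, e2]
        simp
      · simp
      · simp
    have := congrArg D hb
    rw [LieDerivation.apply_lie_eq_add, map_zero] at this
    have t1 := congrArg od₁ this
    have t2 := congrArg od₂ this
    simp only [map_add, od₁_lie, od₂_lie, ev_mk, od₁_mk, od₂_mk, map_zero, mul_zero, o1, o2,
      sub_zero, add_zero, Derivation.leibniz, e1, e2, smul_eq_mul, zero_add,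
      ddx_X_succ (F := F) (show 1 + 1 < 3 ^ n by omega)] at t1 t2
    rw [eq_algebraMap_of_ddx_eq_zero e1] at t1 ⊢
    rw [eq_algebraMap_of_ddx_eq_zero e2] at t2 ⊢
    have key : ∀ r : F, algebraMap F (DivPow F 3 0 n) r * X F n 1 = 0 → r = 0 := fun r hr => by
      rw [← Algebra.smul_def] at hr
      simpa [coeff_X (F := F) (show 1 < 3 ^ n by omega)] using congrArg (coeff 1) hr
    rw [key _ t1, key _ t2, map_zero]
    exact ⟨rfl, rfl⟩
  obtain ⟨b, hb⟩ := exists_ddx_add a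
  have : mk (ddx F n) a 0 0 = mk (ddx F n) (ddx F n b) 0 0 +
      coeff (3 ^ n - 1) a • mk (ddx F n) (X F n (3 ^ n - 1)) 0 0 := by
    ext
    · simpa using hb
    · simp
    · simp
  rw [this]
  simp [hd b, htop]

/-- The linear map that a derivation induces on the even part `A`. -/
def evenPart (D : LieDerivation F (DoubledWitt (ddx F n)) (DoubledWitt (ddx F n))) :
    DivPow F 3 0 n →ₗ[F] DivPow F 3 0 n where
  toFun a := ev (D (mk (ddx F n) a 0 0))
  map_add' a b := by
    rw [← map_add, ← map_add]; congr 2; ext <;> simp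
  map_smul' r a := by
    rw [RingHom.id_apply, ← map_smul, ← map_smul]; congr 2; ext <;> simp

theorem evenPart_apply (a : DivPow F 3 0 n) : evenPart D a = ev (D (mk (ddx F n) a 0 0)) := rfl

include hn he h₁ h₂ in
theorem apply_even (a : DivPow F 3 0 n) :
    D (mk (ddx F n) a 0 0) = mk (ddx F n) (evenPart D a) 0 0 := by
  obtain ⟨e1, e2⟩ := odd_apply_even hn he h₁ h₂ a
  ext
  · rfl
  · simp [e1]
  · simp [e2]

include hn he h₁ h₂ in
theorem apply_odd₁ (f : DivPow F 3 0 n) :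
    D (mk (ddx F n) 0 f 0) = mk (ddx F n) 0 (evenPart D f) 0 := by
  have hd1 := ddx_X_one (F := F) hn
  have : ∀ f, mk (ddx F n) 0 f 0 = ⁅mk (ddx F n) f 0 0, mk (ddx F n) 0 (X F n 1) 0⁆ := fun f => by
    ext <;> simp [hd1]
  rw [this, LieDerivation.apply_lie_eq_add, h₁, lie_zero, zero_add, apply_even hn he h₁ h₂, ← this]

include hn he h₁ h₂ in
theorem apply_odd₂ (f : DivPow F 3 0 n) :
    D (mk (ddx F n) 0 0 f) = mk (ddx F n) 0 0 (evenPart D f) := by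
  have hd1 := ddx_X_one (F := F) hn
  have : ∀ f, mk (ddx F n) 0 0 f = ⁅mk (ddx F n) f 0 0, mk (ddx F n) 0 0 (X F n 1)⁆ := fun f => by
    ext <;> simp [hd1]
  rw [this, LieDerivation.apply_lie_eq_add, h₂, lie_zero, zero_add, apply_even hn he h₁ h₂, ← this]

include he in
theorem evenPart_ddx (a : DivPow F 3 0 n) :
    evenPart D (ddx F n a) = ddx F n (evenPart D a) := by
  have hb : mk (ddx F n) (ddx F n a) 0 0 = ⁅mk (ddx F n) 1 0 0, mk (ddx F n) a 0 0⁆ := by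
    ext <;> simp
  rw [evenPart_apply, hb, apply_lie_one he]
  simp [evenPart_apply]

include hn he h₁ h₂ in
/-- The Leibniz rule, from `[f ⊗ e₁, g ⊗ e₂] = fg`. -/
theorem evenPart_mul (f g : DivPow F 3 0 n) : evenPart D (ddx F n f * ddx F n g) =
    evenPart D (ddx F n f) * ddx F n g + ddx F n f * evenPart D (ddx F n g) := by
  have : ⁅mk (ddx F n) 0 f 0, mk (ddx F n) 0 0 g⁆ = mk (ddx F n) (ddx F n f * ddx F n g) 0 0 := by
    ext <;> simp
  rw [evenPart_apply, ← this, LieDerivation.apply_lie_eq_add, apply_odd₁ hn he h₁ h₂,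
    apply_odd₂ hn he h₁ h₂]
  simp [evenPart_ddx he, add_comm]

include hn he h₁ h₂ in
/-- The constant term of `δ(x^(m))` is zero unless `m` is a power of three: `x^(k) x^(m-k)` is
`binom(m, k) x^(m)`, its image has constant term zero for `0 < k < m` by the Leibniz rule, and only
for powers of three are all these binomial coefficients divisible by three. -/
theorem exists_eq_pow (m : ℕ) (hm : m < 3 ^ n) (hm0 : 0 < m)
    (hc : coeff 0 (evenPart D (X F n m)) ≠ 0) :
    ∃ j, m = 3 ^ j := by
  have : Fact (Nat.Prime 3) := ⟨Nat.prime_three⟩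
  refine ⟨_, Choose.eq_pow_multiplicity_of_choose_modEq_zero_nat (p := 3) hm0 fun k hk => ?_⟩
  rw [Finset.mem_Icc] at hk
  have h := evenPart_mul hn he h₁ h₂ (X F n (m - k + 1)) (X F n (k + 1))
  rw [ddx_X_succ (by omega), ddx_X_succ (by omega), X_mul_X, map_smul,
    show m - k + k = m by omega] at h
  have h := congrArg (coeff 0) h
  rw [map_add, mul_comm (X F n (m - k)), coeff_zero_mul_X _ (by omega),
    coeff_zero_mul_X _ (by omega), map_smul, add_zero, smul_eq_mul] at h
  exact (Nat.modEq_zero_iff_dvd).2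
    ((CharP.cast_eq_zero_iff F 3 _).1 ((mul_eq_zero.1 h).resolve_right hc))

include hn he h₁ h₂ in
theorem exists_eq_outerRep (hx : D (mk (ddx F n) (X F n 1) 0 0) = 0) :
    ∃ s, D = outerRep F n s := by
  have h9 : 3 ^ 2 ≤ 3 ^ n := Nat.pow_le_pow_right (by norm_num) hn
  -- The coefficient of `(d/dx)^m` is the constant term of the image of `x^(m)`.
  let c : AbelianLie F (n - 1) := fun j => coeff 0 (evenPart D (X F n (3 ^ (j.1 + 1))))
  have hc : ∀ j, c j = coeff 0 (evenPart D (X F n (3 ^ (j.1 + 1)))) := fun _ => rfl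
  have key : evenPart D = (ddxPowSum n c : DivPow F 3 0 n →ₗ[F] DivPow F 3 0 n) := by
    refine eq_of_commute_ddx (evenPart_ddx he) (ddxPowSum_comm_ddx c) fun m hm => ?_
    rw [Derivation.coeFn_coe, coeff_ddxPowSum]
    by_cases hj : ∃ j : Fin (n - 1), m = 3 ^ (j.1 + 1)
    · obtain ⟨j, rfl⟩ := hj
      rw [Finset.sum_eq_single j, coeff_X hm, zero_add, if_pos rfl, mul_one, hc]
      · intro i _ hij
        rw [coeff_X hm, zero_add, if_neg, mul_zero]
        intro h
        have := Nat.pow_right_injective (le_refl 3 |>.trans' (by norm_num)) h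
        exact hij (Fin.ext (by omega))
      · simp
    · rw [Finset.sum_eq_zero]
      · by_contra hne
        have hm0 : 0 < m := by
          rcases Nat.eq_zero_or_pos m with rfl | h
          · exact absurd (by rw [evenPart_apply, X_zero, he]; simp) hne
          · exact h
        obtain ⟨j, rfl⟩ := exists_eq_pow hn he h₁ h₂ m hm hm0 hne
        have hjn : j < n := (Nat.pow_lt_pow_iff_right (by norm_num)).1 hm
        cases j with
        | zero => exact absurd (by rw [evenPart_apply, pow_zero, hx]; simp) hne
        | succ j => exact hj ⟨⟨j, by omega⟩, rfl⟩
      · intro j _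
        rw [coeff_X hm, zero_add, if_neg fun h => hj ⟨j, h⟩, mul_zero]
  refine ⟨(0, c), LieDerivation.ext fun x => ?_⟩
  have hv : ∀ i, (0 : AbelianLie F 2) i = 0 := fun _ => rfl
  obtain ⟨a, f, g, rfl⟩ := exists_mk x
  have : mk (ddx F n) a f g = mk (ddx F n) a 0 0 + mk (ddx F n) 0 f 0 + mk (ddx F n) 0 0 g := by
    ext <;> simp
  rw [this, map_add, map_add, apply_even hn he h₁ h₂, apply_odd₁ hn he h₁ h₂,
    apply_odd₂ hn he h₁ h₂, key, ← this, outerRep_apply]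
  ext <;> simp [hv, ddxPowSum_comm_ddx]

end Normalized

/-- Every derivation of the model is the sum of one from `outerRep` and an inner one. -/
theorem exists_eq_outerRep_add_ad
    (D : LieDerivation F (DoubledWitt (ddx F n)) (DoubledWitt (ddx F n))) (hn : 1 < n) :
    ∃ s y, D = outerRep F n s + LieDerivation.ad F _ y := by
  obtain ⟨s₁, y₁, h₁⟩ := exists_sub_apply_mk_one D hn
  obtain ⟨s₂, he, a, b, c, d⟩ := exists_sub_apply_odd hn h₁
  obtain ⟨y₂, he, hx, h₁, h₂⟩ := exists_sub_ad_apply hn he a b c d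
  obtain ⟨s₃, hs⟩ := exists_eq_outerRep hn he h₁ h₂ hx
  refine ⟨s₁ + s₂ + s₃, y₁ + y₂, ?_⟩
  rw [map_add, map_add, map_add, ← hs]
  abel

end DivPow

/-! ### Outer derivations of isomorphic Lie algebras -/

/-- The transport of derivations along an isomorphism of Lie algebras. -/
def LieDerivation.conj {F L L' : Type*} [CommRing F] [LieRing L] [LieAlgebra F L] [LieRing L']
    [LieAlgebra F L'] (e : L ≃ₗ⁅F⁆ L') : LieDerivation F L L →ₗ⁅F⁆ LieDerivation F L' L' where
  toFun D :=
    { toLinearMap := (e : L →ₗ[F] L') ∘ₗ D.toLinearMap ∘ₗ (e.symm : L' →ₗ[F] L)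
      leibniz' := fun a b => by
        change e (D (e.symm ⁅a, b⁆)) = ⁅a, e (D (e.symm b))⁆ - ⁅b, e (D (e.symm a))⁆
        rw [LieEquiv.map_lie, LieDerivation.apply_lie_eq_sub, map_sub, LieEquiv.map_lie,
          LieEquiv.map_lie, LieEquiv.apply_symm_apply, LieEquiv.apply_symm_apply] }
  map_add' D D' := LieDerivation.ext fun x => map_add e _ _
  map_smul' r D := LieDerivation.ext fun x => map_smul e _ _
  map_lie' {D D'} := LieDerivation.ext fun x => by
    rw [LieDerivation.commutator_apply]
    change e (⁅D, D'⁆ (e.symm x)) = e (D (e.symm (e (D' (e.symm x))))) -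
      e (D' (e.symm (e (D (e.symm x)))))
    rw [LieDerivation.commutator_apply, map_sub, LieEquiv.symm_apply_apply,
      LieEquiv.symm_apply_apply]

theorem LieDerivation.conj_apply {F L L' : Type*} [CommRing F] [LieRing L] [LieAlgebra F L]
    [LieRing L'] [LieAlgebra F L'] (e : L ≃ₗ⁅F⁆ L') (D : LieDerivation F L L) (x : L') :
    LieDerivation.conj e D x = e (D (e.symm x)) := rfl

theorem LieDerivation.conj_ad {F L L' : Type*} [CommRing F] [LieRing L] [LieAlgebra F L]
    [LieRing L'] [LieAlgebra F L'] (e : L ≃ₗ⁅F⁆ L') (y : L) :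
    LieDerivation.conj e (LieDerivation.ad F L y) = LieDerivation.ad F L' (e y) := by
  refine LieDerivation.ext fun x => ?_
  rw [LieDerivation.conj_apply]
  simp [LieEquiv.map_lie]

theorem LieDerivation.conj_symm_conj {F L L' : Type*} [CommRing F] [LieRing L] [LieAlgebra F L]
    [LieRing L'] [LieAlgebra F L'] (e : L ≃ₗ⁅F⁆ L') (D : LieDerivation F L L) :
    LieDerivation.conj e.symm (LieDerivation.conj e D) = D := by
  refine LieDerivation.ext fun x => ?_
  simp [LieDerivation.conj_apply]

/-- A criterion for `Out(L') ≃ S`, where `L'` is isomorphic to `L`: there is a linear map from `S`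
to the derivations of `L` that respects brackets modulo inner derivations and identifies `S` with a
complement of them. -/
theorem OuterDerivations.nonempty_lieEquiv {F L L' S : Type*} [CommRing F] [LieRing L]
    [LieAlgebra F L] [LieRing L'] [LieAlgebra F L'] [LieRing S] [LieAlgebra F S] (e : L ≃ₗ⁅F⁆ L')
    (ψ : S →ₗ[F] LieDerivation F L L)
    (hlie : ∀ s t, ∃ y, ⁅ψ s, ψ t⁆ = ψ ⁅s, t⁆ + LieDerivation.ad F L y)
    (hinj : ∀ s y, ψ s = LieDerivation.ad F L y → s = 0)
    (hsurj : ∀ D, ∃ s y, D = ψ s + LieDerivation.ad F L y) :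
    Nonempty (OuterDerivations F L' ≃ₗ⁅F⁆ S) := by
  have hq : ∀ D D' : LieDerivation F L' L',
      (LieSubmodule.Quotient.mk D : OuterDerivations F L') = LieSubmodule.Quotient.mk D' ↔
        ∃ y, D - D' = LieDerivation.ad F L' y := fun D D' => by
    rw [← sub_eq_zero]
    change LieSubmodule.Quotient.mk (D - D') = (0 : OuterDerivations F L') ↔ _
    rw [LieSubmodule.Quotient.mk_eq_zero', LieDerivation.mem_ad_idealRange_iff]
    simp [eq_comm]
  let Ψ : S →ₗ⁅F⁆ OuterDerivations F L' :=
    { toFun := fun s => LieSubmodule.Quotient.mk (LieDerivation.conj e (ψ s))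
      map_add' := fun s t => by rw [map_add, map_add]; rfl
      map_smul' := fun r s => by rw [map_smul, map_smul]; rfl
      map_lie' := fun {s t} => by
        change LieSubmodule.Quotient.mk (LieDerivation.conj e (ψ ⁅s, t⁆)) =
          ⁅(LieSubmodule.Quotient.mk (LieDerivation.conj e (ψ s)) : OuterDerivations F L'),
            LieSubmodule.Quotient.mk (LieDerivation.conj e (ψ t))⁆
        rw [← LieSubmodule.Quotient.mk_bracket, ← LieHom.map_lie, eq_comm, hq]
        obtain ⟨y, hy⟩ := hlie s t
        exact ⟨e y, by rw [hy, map_add, add_sub_cancel_left, LieDerivation.conj_ad]⟩ }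
  have hΨ : ∀ s, Ψ s = LieSubmodule.Quotient.mk (LieDerivation.conj e (ψ s)) := fun _ => rfl
  refine ⟨(LieEquiv.ofBijective Ψ ⟨?_, ?_⟩).symm⟩
  · rw [injective_iff_map_eq_zero]
    intro s hs
    rw [hΨ] at hs
    obtain ⟨y, hy⟩ := (hq _ 0).1 hs
    refine hinj s (e.symm y) ?_
    rw [← LieDerivation.conj_ad, ← hy, sub_zero, LieDerivation.conj_symm_conj]
  · intro D
    obtain ⟨D, rfl⟩ := LieSubmodule.Quotient.surjective_mk' _ D
    obtain ⟨s, y, h⟩ := hsurj (LieDerivation.conj e.symm D)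
    refine ⟨s, (hΨ s).trans ((hq _ _).2 ⟨e (-y), ?_⟩)⟩
    have h := congrArg (LieDerivation.conj e) h
    rw [show LieDerivation.conj e (LieDerivation.conj e.symm D) = D from
      LieDerivation.conj_symm_conj e.symm D, map_add, LieDerivation.conj_ad] at h
    rw [h, map_neg, map_neg]
    abel

/-! ### The model is `H(2; (1, n))^(2)` -/

namespace DivPow

open DoubledWitt

variable {F : Type*} [Field F] {n : ℕ}

variable (F n) in
/-- The inclusion of `O(1; n)` into `O(2; (1, n))` as the divided powers of `x₂`. -/
def incl₂ : DivPow F 3 0 n →ₗ[F] DivPow F 3 1 n := lift mon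

theorem incl₂_X (k : ℕ) : incl₂ F n (X F n k) = mon (0, k) := by
  refine lift_mon' _ _ fun h => mon_eq_zero _ fun h' => h ⟨by simp, h'.2⟩

theorem incl₂_mul (a b : DivPow F 3 0 n) : incl₂ F n (a * b) = incl₂ F n a * incl₂ F n b := by
  have h1 : ∀ k m, incl₂ F n (X F n k * X F n m) = incl₂ F n (X F n k) * incl₂ F n (X F n m) := by
    intro k m
    rw [X_mul_X, map_smul, incl₂_X, incl₂_X, incl₂_X, mon_mul_mon]
    simp
  have h2 : ∀ k b, incl₂ F n (X F n k * b) = incl₂ F n (X F n k) * incl₂ F n b := fun k b =>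
    congrArg (fun φ => φ b) (show incl₂ F n ∘ₗ LinearMap.mulLeft F (X F n k) =
      LinearMap.mulLeft F (incl₂ F n (X F n k)) ∘ₗ incl₂ F n from hom_ext_X fun m _ => h1 k m)
  exact congrArg (fun φ => φ a) (show incl₂ F n ∘ₗ LinearMap.mulRight F b =
    LinearMap.mulRight F (incl₂ F n b) ∘ₗ incl₂ F n from hom_ext_X fun k _ => h2 k b)

variable [CharP F 3]

theorem partial₁_incl₂ (a : DivPow F 3 0 n) : partial₁ F 3 1 n (incl₂ F n a) = 0 :=
  congrArg (fun φ => φ a) (show partial₁Hom ∘ₗ incl₂ F n = 0 from hom_ext_X fun k hk => by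
    rw [LinearMap.comp_apply, incl₂_X, partial₁Hom_mon _ ⟨by simp, hk⟩]
    simp)

theorem partial₂_incl₂ (a : DivPow F 3 0 n) :
    partial₂ F 3 1 n (incl₂ F n a) = incl₂ F n (ddx F n a) :=
  congrArg (fun φ => φ a) (show partial₂Hom ∘ₗ incl₂ F n =
      incl₂ F n ∘ₗ (ddx F n : DivPow F 3 0 n →ₗ[F] DivPow F 3 0 n) from hom_ext_X fun k hk => by
    rw [LinearMap.comp_apply, LinearMap.comp_apply, incl₂_X, partial₂Hom_mon _ ⟨by simp, hk⟩,
      Derivation.coeFn_coe]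
    cases k with
    | zero => simp [ddx_X_zero]
    | succ k => rw [ddx_X_succ hk, incl₂_X]; simp)

omit [CharP F 3] in
theorem incl₂_injective : Function.Injective (incl₂ F n) := by
  have h : (lift fun c => X F n c.2) ∘ₗ incl₂ F n = LinearMap.id := hom_ext_X fun k hk => by
    rw [LinearMap.comp_apply, incl₂_X, lift_mon _ _ ⟨by simp, hk⟩, LinearMap.id_apply]
  exact Function.LeftInverse.injective (g := lift fun c => X F n c.2) fun a =>
    congrArg (fun φ => φ a) h

variable (F n) in
/-- The element `x₁` of `O(2; (1, n))`. -/
def x₁ : DivPow F 3 1 n := mon (1, 0)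

variable (F n) in
/-- The element `x₁^(2)` of `O(2; (1, n))`. -/
def x₁sq : DivPow F 3 1 n := mon (2, 0)

theorem partial₁_x₁ : partial₁ F 3 1 n (x₁ F n) = 1 := by
  rw [partial₁_apply, x₁, partial₁Hom_mon _ ⟨by simp, by simp⟩]; rfl

theorem partial₂_x₁ : partial₂ F 3 1 n (x₁ F n) = 0 := by
  rw [partial₂_apply, x₁, partial₂Hom_mon _ ⟨by simp, by simp⟩]; rfl

theorem partial₁_x₁sq : partial₁ F 3 1 n (x₁sq F n) = x₁ F n := by
  rw [partial₁_apply, x₁sq, partial₁Hom_mon _ ⟨by simp, by simp⟩]; rfl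

theorem partial₂_x₁sq : partial₂ F 3 1 n (x₁sq F n) = 0 := by
  rw [partial₂_apply, x₁sq, partial₂Hom_mon _ ⟨by simp, by simp⟩]; rfl

omit [CharP F 3] in
theorem x₁_mul_x₁ : x₁ F n * x₁ F n = 2 * x₁sq F n := by
  rw [x₁, mon_mul_mon, x₁sq, two_mul, ← two_smul F (mon (2, 0) : DivPow F 3 1 n)]
  simp

omit [CharP F 3] in
theorem x₁_mul_x₁sq : x₁ F n * x₁sq F n = 0 := by
  rw [x₁, x₁sq, mon_mul_mon, mon_eq_zero, smul_zero]
  simp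

variable (F n) in
/-- The map from the model to the derivations of `O(2; (1, n))` given by `a ↦ D_H(x₁ a)`,
`f ⊗ e₁ ↦ D_H(x₁^(2) f)` and `g ⊗ e₂ ↦ -g ∂₁`, where `a`, `f`, `g` are functions of `x₂`. If
`g = G'`, then `-g ∂₁ = D_H(G)`. -/
def toDer : DoubledWitt (ddx F n) →ₗ[F] Derivation F (DivPow F 3 1 n) (DivPow F 3 1 n) where
  toFun x := DH F 3 1 n (x₁ F n * incl₂ F n (ev x) + x₁sq F n * incl₂ F n (od₁ x)) -
    incl₂ F n (od₂ x) • partial₁ F 3 1 n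
  map_add' x y := by simp only [map_add, mul_add, add_smul]; abel
  map_smul' r x := by
    simp only [map_smul, mul_smul_comm, ← smul_add, RingHom.id_apply, smul_sub, smul_assoc]

theorem toDer_apply (x : DoubledWitt (ddx F n)) (h : DivPow F 3 1 n) : toDer F n x h =
    (incl₂ F n (ev x) + x₁ F n * incl₂ F n (od₁ x)) * partial₂ F 3 1 n h
    - (x₁ F n * incl₂ F n (ddx F n (ev x)) + x₁sq F n * incl₂ F n (ddx F n (od₁ x))
      + incl₂ F n (od₂ x)) * partial₁ F 3 1 n h := by
  change DH F 3 1 n _ h - incl₂ F n (od₂ x) * partial₁ F 3 1 n h = _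
  rw [DH_apply]
  simp only [map_add, Derivation.leibniz, smul_eq_mul, partial₁_incl₂, partial₂_incl₂, partial₁_x₁,
    partial₂_x₁, partial₁_x₁sq, partial₂_x₁sq]
  ring

theorem toDer_lie (x y : DoubledWitt (ddx F n)) :
    toDer F n ⁅x, y⁆ = ⁅toDer F n x, toDer F n y⁆ := by
  ext h
  rw [Derivation.commutator_apply]
  simp only [toDer_apply, map_add, map_sub, Derivation.leibniz, smul_eq_mul, partial₁_incl₂,
    partial₂_incl₂, partial₁_x₁, partial₂_x₁, partial₁_x₁sq, partial₂_x₁sq, partial_comm,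
    ev_lie, od₁_lie, od₂_lie, incl₂_mul]
  have h11 := x₁_mul_x₁ (F := F) (n := n)
  have h12 := x₁_mul_x₁sq (F := F) (n := n)
  have h3 := algebra_three_eq_zero F (DivPow F 3 1 n)
  generalize incl₂ F n (ddx F n (ddx F n (ev x))) = a''
  generalize incl₂ F n (ddx F n (ddx F n (ev y))) = b''
  generalize incl₂ F n (ddx F n (ddx F n (od₁ x))) = f''
  generalize incl₂ F n (ddx F n (ddx F n (od₁ y))) = k''
  generalize incl₂ F n (ddx F n (ev x)) = a'
  generalize incl₂ F n (ddx F n (ev y)) = b'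
  generalize incl₂ F n (ddx F n (od₁ x)) = f'
  generalize incl₂ F n (ddx F n (od₁ y)) = k'
  generalize incl₂ F n (ev x) = a
  generalize incl₂ F n (ev y) = b
  generalize incl₂ F n (od₁ x) = f
  generalize incl₂ F n (od₁ y) = k
  linear_combination
    ((x₁ F n * (a' * k - b' * f) - x₁sq F n * (f * k' - k * f')) * h3 - (f * k' - k * f') * h11) *
      partial₂ F 3 1 n h +
    ((f * b'' - a' * k' - k * a'' + b' * f') * h11 + (f * k'' - k * f'') * h12 -
      x₁sq F n * (a' * k' + a'' * k - b' * f' - b'' * f) * h3) * partial₁ F 3 1 n h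

theorem toDer_injective (hn : 1 < n) : Function.Injective (toDer F n) := by
  rw [injective_iff_map_eq_zero]
  intro x hx
  have h1 := congrArg (fun D => D (x₁ F n)) hx
  have h2 := congrArg (fun D => D (mon (0, 1))) hx
  have e1 : partial₁ F 3 1 n (mon (0, 1)) = 0 := by
    rw [← incl₂_X, partial₁_incl₂]
  have e2 : partial₂ F 3 1 n (mon (0, 1)) = 1 := by
    rw [← incl₂_X, partial₂_incl₂, ddx_X_one hn, ← X_zero, incl₂_X]; rfl
  simp only [toDer_apply, e1, e2, mul_zero, mul_one, sub_zero, Derivation.zero_apply, partial₁_x₁,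
    partial₂_x₁, zero_sub] at h1 h2
  have ho₁ : od₁ x = 0 := by
    refine incl₂_injective ?_
    have := congrArg (partial₁ F 3 1 n) h2
    simpa [partial₁_incl₂, partial₁_x₁] using this
  have he : ev x = 0 := by
    refine incl₂_injective ?_
    simpa [ho₁] using h2
  have ho₂ : od₂ x = 0 := by
    refine incl₂_injective ?_
    simpa [ho₁, he] using h1
  exact DoubledWitt.ext he ho₁ ho₂

theorem toDer_mem (x : DoubledWitt (ddx F n)) : toDer F n x ∈ Hamiltonian₂ F 3 1 n := by
  obtain ⟨a, f, g, rfl⟩ := exists_mk x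
  -- `∂₁` and `∂₂` of any element avoid the top monomial, so `D_H` maps them into the algebra.
  have : toDer F n (mk (ddx F n) a f g) = DH F 3 1 n (partial₁ F 3 1 n (x₁sq F n * incl₂ F n a)
      + partial₂ F 3 1 n (x₁sq F n * incl₂ F n f) + partial₁ F 3 1 n (x₁ F n * incl₂ F n g)) := by
    ext h
    rw [toDer_apply, DH_apply]
    simp only [map_add, Derivation.leibniz, smul_eq_mul, partial₁_incl₂,
      partial₂_incl₂, partial₁_x₁, partial₂_x₁, partial₁_x₁sq, partial₂_x₁sq, ev_mk, od₁_mk, od₂_mk,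
      map_zero, Derivation.map_one_eq_zero]
    ring
  rw [this]
  exact DH_mem (add_mem (add_mem (partial₁_mem _) (partial₂_mem _)) (partial₁_mem _))

theorem le_range_toDer (hn : 1 < n) :
    (Hamiltonian₂ F 3 1 n).toSubmodule ≤ LinearMap.range (toDer F n) := by
  refine Submodule.span_le.2 ?_
  rintro _ ⟨⟨i, j⟩, h0, ht, rfl⟩
  have h9 : 3 ^ 2 ≤ 3 ^ n := Nat.pow_le_pow_right (by norm_num) hn
  simp only [tau, pow_one, Prod.mk_lt_mk] at ht
  have hx : ∀ i j, (mon (i, j) : DivPow F 3 1 n) = mon (i, 0) * incl₂ F n (X F n j) := fun i j => by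
    rw [incl₂_X, mon_mul_mon]; simp
  have hj : j < 3 ^ n := by omega
  have hi : i < 3 := by omega
  rw [hx]
  interval_cases i
  · have : j ≠ 0 := by rintro rfl; exact lt_irrefl _ h0
    obtain ⟨k, rfl⟩ := Nat.exists_eq_succ_of_ne_zero this
    refine ⟨mk (ddx F n) 0 0 (X F n (k + 1)), ?_⟩
    ext h
    have : (mon (0, 0) : DivPow F 3 1 n) = 1 := rfl
    simp only [toDer_apply, DH_apply, partial₁_incl₂, partial₂_incl₂, ev_mk, od₁_mk, od₂_mk,
      map_zero, this, one_mul]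
    ring
  · refine ⟨mk (ddx F n) (X F n j) 0 0, ?_⟩
    ext h
    have : (mon (1, 0) : DivPow F 3 1 n) = x₁ F n := rfl
    simp only [toDer_apply, DH_apply, Derivation.leibniz, smul_eq_mul, partial₁_incl₂,
      partial₂_incl₂, ev_mk, od₁_mk, od₂_mk, partial₁_x₁, partial₂_x₁,
      map_zero, this]
    ring
  · refine ⟨mk (ddx F n) 0 (X F n (j + 1)) 0, ?_⟩
    ext h
    have : (mon (2, 0) : DivPow F 3 1 n) = x₁sq F n := rfl
    simp only [toDer_apply, DH_apply, Derivation.leibniz, smul_eq_mul, partial₁_incl₂,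
      partial₂_incl₂, ev_mk, od₁_mk, od₂_mk, partial₁_x₁sq, partial₂_x₁sq,
      map_zero, this, ddx_X_succ (F := F) (show j + 1 < 3 ^ n by omega)]
    ring

/-- The model is isomorphic to the Hamiltonian algebra. -/
def modelEquiv (hn : 1 < n) : DoubledWitt (ddx F n) ≃ₗ⁅F⁆ Hamiltonian₂ F 3 1 n :=
  LieEquiv.ofBijective
    { (toDer F n).codRestrict (Hamiltonian₂ F 3 1 n).toSubmodule toDer_mem with
      map_lie' := fun {x y} => Subtype.ext (toDer_lie x y) }
    ⟨fun x y h => toDer_injective hn (congrArg Subtype.val h), fun D => by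
      obtain ⟨x, hx⟩ := le_range_toDer hn D.2
      exact ⟨x, Subtype.ext hx⟩⟩

end DivPow

/-! ### The dimension -/

theorem LieAlgebra.SpecialLinear.finrank_sl_two (F : Type*) [Field F] :
    Module.finrank F (LieAlgebra.SpecialLinear.sl (Fin 2) F) = 3 := by
  have h := LinearMap.finrank_range_add_finrank_ker (Matrix.traceLinearMap (Fin 2) F F)
  have hs : Function.Surjective (Matrix.traceLinearMap (Fin 2) F F) := fun r =>
    ⟨!![r, 0; 0, 0], by simp [Matrix.trace_fin_two]⟩
  rw [LinearMap.range_eq_top.2 hs, finrank_top, Module.finrank_self,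
    Module.finrank_matrix, Module.finrank_self, Fintype.card_fin] at h
  change Module.finrank F (LinearMap.ker (Matrix.traceLinearMap (Fin 2) F F)) = 3
  omega

theorem finrank_sl₂SemidirectV₂_prod (F : Type*) [Field F] {n : ℕ} (hn : 1 < n) :
    Module.finrank F (Sl₂SemidirectV₂ F × AbelianLie F (n - 1)) = n + 4 := by
  have h2 : ∀ k, Module.finrank F (AbelianLie F k) = k := fun k => Module.finrank_fin_fun F
  have : ∀ k, Module.Finite F (AbelianLie F k) := fun k =>
    inferInstanceAs (Module.Finite F (Fin k → F))
  have : Module.Finite F (LieAlgebra.SpecialLinear.sl (Fin 2) F) :=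
    inferInstanceAs (Module.Finite F (LinearMap.ker (Matrix.traceLinearMap (Fin 2) F F)))
  let e := LieAlgebra.SemiDirectSum.toProdl (sl₂NaturalAction F)
  have : Module.Finite F (Sl₂SemidirectV₂ F) := Module.Finite.equiv e.symm
  rw [Module.finrank_prod, e.finrank_eq, Module.finrank_prod, h2, h2,
    LieAlgebra.SpecialLinear.finrank_sl_two]
  omega

theorem theorem3p5 (F : Type*) [Field F] [CharP F 3] (n : ℕ) (hn : 1 < n) :
    Nonempty (OuterDerivations F (Hamiltonian₂ F 3 1 n) ≃ₗ⁅F⁆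
      (Sl₂SemidirectV₂ F × AbelianLie F (n - 1))) ∧
    Module.finrank F (OuterDerivations F (Hamiltonian₂ F 3 1 n)) = n + 4 := by
  have h := OuterDerivations.nonempty_lieEquiv (DivPow.modelEquiv hn) (DivPow.outerRep F n)
    (DivPow.lie_outerRep hn) (DivPow.eq_zero_of_outerRep_eq_ad hn)
    fun D => DivPow.exists_eq_outerRep_add_ad D hn
  exact ⟨h, h.some.toLinearEquiv.finrank_eq.trans (finrank_sl₂SemidirectV₂_prod F hn)⟩

end
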